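/- **Lemma (boundedness of the $H^1(\mathbb{R}^3)$-norm).** Let $\lambda>0$ and $$V(x-y,x-z)=\lambda\left(\frac{1}{|x-y|\,|x-z|}+\frac{1}{|y-z|\,|y-x|}+\frac{1}{|z-x|\,|z-y|}\right),\qquad x,y,z\in\mathbb{R}^3 .$$ For every $M\in\mathbb{R}$ there is a constant $C$, depending only on $\lambda$ and $M$, such that the following holds. Let $J\subseteq\mathbb{R}$ be an interval containing $0$ (for instance $J=\mathbb{R}$ or $J=[0,\infty)$), let $\varphi_0\in H^1(\mathbb{R}^3)$, and let $\varphi_t$, $t\in J$, be an $H^1$-solution on $J$ of the quintic Hartree equation $$\mathrm{i}\,\partial_t\varphi_t=-\Delta\varphi_t+\frac12\left(\int_{\mathbb{R}^3}\int_{\mathbb{R}^3} V(x-y,x-z)\,|\varphi_t(y)|^2\,|\varphi_t(z)|^2\,\mathrm{d}y\,\mathrm{d}z\right)\varphi_t$$ with initial data $\varphi_{t=0}=\varphi_0$, that is, $t\mapsto\varphi_t$ is continuous from $J$ to $H^1(\mathbb{R}^3)$ and the equation holds at every $t\in J$ in the sense of distributions on $\mathbb{R}^3$ (tested against Schwartz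 functions). If $\|\varphi_0\|_{H^1}<M$, then $$\|\varphi_t\|_{H^1}\le C\qquad\text{for all } t\in J .$$ Here $\|f\|_{H^1}^2=\|f\|_{L^2}^2+\|\nabla f\|_{L^2}^2$. -/

import Mathlib

open MeasureTheory
open scoped SchwartzMap LineDeriv Laplacian ENNReal

noncomputable section

namespace QuinticHartree

/-- The physical space `ℝ³` with its Euclidean norm. -/
abbrev E3 : Type := EuclideanSpace ℝ (Fin 3)

/-- The complex Hilbert space `L²(ℝ³)`. -/
abbrev L2 : Type := Lp ℂ 2 (volume : Measure E3)

/-- `L²(ℝ³) ⊕ L²(ℝ³)³` with its Hilbert norm: the ambient space of pairs (function, gradient). -/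
abbrev L2Pair : Type := WithLp 2 (L2 × PiLp 2 (fun _ : Fin 3 => L2))

/-- `g = (g₀, g₁, g₂)` is the weak gradient of `f`: in the sense of (tempered) distributions,
`∂ᵢ f = gᵢ` for every coordinate direction `i`. -/
def HasWeakGradient (f : L2) (g : Fin 3 → L2) : Prop :=
  ∀ i : Fin 3, ∂_{(EuclideanSpace.single i 1 : E3)} (f : 𝓢'(E3, ℂ)) = (g i : 𝓢'(E3, ℂ))

/-- The Sobolev space `H¹(ℝ³)`: the `L²` functions with a weak gradient in `L²`, recorded together
with that (unique) gradient. The norm inherited from the ambient space is the usual one,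
`‖f‖² = ‖f‖²_{L²} + ‖∇f‖²_{L²}`. -/
def H1 : Submodule ℂ L2Pair where
  carrier := {p | HasWeakGradient p.fst (fun i => p.snd i)}
  zero_mem' := by
    intro i
    simp only [WithLp.zero_fst, WithLp.zero_snd, PiLp.zero_apply,
      ← Lp.toTemperedDistributionCLM_apply, map_zero]
    exact LineDeriv.lineDerivOp_zero _
  add_mem' := by
    intro p q hp hq i
    have h1 := hp i
    have h2 := hq i
    simp only [WithLp.add_fst, WithLp.add_snd, PiLp.add_apply,
      ← Lp.toTemperedDistributionCLM_apply, map_add] at h1 h2 ⊢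
    rw [LineDeriv.lineDerivOp_add, h1, h2]
  smul_mem' := by
    intro c p hp i
    have h1 := hp i
    simp only [WithLp.smul_fst, WithLp.smul_snd, PiLp.smul_apply,
      ← Lp.toTemperedDistributionCLM_apply, map_smul] at h1 ⊢
    rw [LineDeriv.lineDerivOp_smul, h1]

/-- The `L²` function underlying an element of `H¹(ℝ³)`. -/
def toL2 (u : H1) : L2 := (u : L2Pair).fst

/-- The three-body interaction potential `V(x-y, x-z) = λ (v(x-y) v(x-z) + v(y-z) v(y-x) +
v(z-x) v(z-y))` with the Coulomb potential `v(x) = 1/|x|`, as a function of `x`, `y`, `z`. -/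
def V (lam : ℝ) (x y z : E3) : ℝ :=
  lam * (‖x - y‖⁻¹ * ‖x - z‖⁻¹ + ‖y - z‖⁻¹ * ‖y - x‖⁻¹ + ‖z - x‖⁻¹ * ‖z - y‖⁻¹)

/-- The mean-field potential `x ↦ ½ ∫∫ V(x-y, x-z) |f(y)|² |f(z)|² dy dz` generated by `f`. -/
def meanField (lam : ℝ) (f : E3 → ℂ) (x : E3) : ℝ :=
  (1 / 2) * ∫ y, ∫ z, V lam x y z * ‖f y‖ ^ 2 * ‖f z‖ ^ 2

/-- `φ` is an `H¹` solution, on the time interval `J`, of the quintic Hartree equation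
`i ∂ₜφ = -Δφ + ½ (∫∫ V(x-y, x-z) |φ(y)|² |φ(z)|² dy dz) φ` with initial datum `φ₀` at time `0`:
it is continuous in time with values in `H¹(ℝ³)`, and the equation holds at every time of `J` in
the sense of distributions on `ℝ³`. -/
structure IsSolution (lam : ℝ) (J : Set ℝ) (φ₀ : H1) (φ : ℝ → H1) : Prop where
  initial : φ 0 = φ₀
  continuousOn : ContinuousOn φ J
  equation : ∀ t ∈ J, ∀ ψ : 𝓢(E3, ℂ), ∃ d : ℂ,
    HasDerivWithinAt (fun s : ℝ => (toL2 (φ s) : 𝓢'(E3, ℂ)) ψ) d J t ∧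
    Complex.I * d = -(Δ (toL2 (φ t) : 𝓢'(E3, ℂ))) ψ +
      ∫ x, ψ x * ((meanField lam (toL2 (φ t)) x : ℂ) * toL2 (φ t) x)

end QuinticHartree

end

noncomputable section

namespace QuinticHartree

open Filter Topology

/-! The bound is conservation of mass plus energy. With `ρ = |φ|²` and the Coulomb potential `pot
ρ`, Fubini turns the mean field into `meanPot lam ρ`, which is the derivative in `ρ` of the
nonnegative functional `interaction lam ρ`. Formally `‖φ‖²_{H¹} + interaction lam |φ|²` is then
constant along the flow. Dropping the interaction at time `t` and bounding it at time `0` by a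
multiple of `‖φ₀‖⁶` gives the claim.

Two points need care. The first is that the nonlinearity must act on `H¹`. Hardy's inequality
(`hardy`) makes `∫ |x - y|⁻² |u(y)| |v(y)| dy` bounded uniformly in `x`. Hence the potentials of
such densities are bounded and Lipschitz (`HardyDensity.bddLip_pot`), and multiplication by a
bounded Lipschitz function preserves `H¹` (`BddLip.exists_mul`). All these bounds are multilinear in
the densities, which yields continuity of the nonlinearity `H¹ → H¹`.

The second is that the equation holds only in the sense of distributions, so `‖φ‖²` cannot be
differentiated directly. Let `ι : H¹ → L²` be the embedding and `S = ι* ι`, which plays the role of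
`(1 - Δ)⁻¹`. The equation becomes `(Sφ)' = -i (φ - Sφ + S N(φ))` in `H¹`. The regularized norms `‖S
(S + ε)⁻¹ φ‖²` are differentiable, and letting `ε → 0` after integrating in time gives the increment
of `‖φ‖²` as an integral of `2 Im ⟨φ, N(φ)⟩`. The interaction is differentiated through an exact
discrete gradient (`interaction_dens_sub`), which needs only the derivative of `Sφ`; the two
contributions cancel (`norm_sq_add_eq_of_weak_equation`). -/

/-- The `i`-th coordinate direction of `ℝ³`. -/
abbrev e (i : Fin 3) : E3 := EuclideanSpace.single i 1

/-! ### Testing against Schwartz functions and the Hilbert structure of `H¹` -/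

/-- Integral of the product of a Schwartz function and an `L²` function. -/
def pair (ψ : 𝓢(E3, ℂ)) : L2 →L[ℂ] ℂ :=
  PointwiseConvergenceCLM.evalCLM (RingHom.id ℂ) ℂ ψ ∘L Lp.toTemperedDistributionCLM ℂ volume 2

theorem pair_apply (ψ : 𝓢(E3, ℂ)) (f : L2) : pair ψ f = ∫ x, ψ x * f x := by
  change (f : 𝓢'(E3, ℂ)) ψ = _
  simp

theorem hasWeakGradient_iff (f : L2) (g : Fin 3 → L2) :
    HasWeakGradient f g ↔ ∀ (i : Fin 3) (ψ : 𝓢(E3, ℂ)), pair ψ (g i) = - pair (∂_{e i} ψ) f := by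
  refine forall_congr' fun i => ?_
  constructor
  · intro h ψ
    have := congrArg (fun T : 𝓢'(E3, ℂ) => T ψ) h
    simp only [TemperedDistribution.lineDerivOp_apply_apply, map_neg] at this
    exact this.symm
  · intro h
    ext ψ
    simp only [TemperedDistribution.lineDerivOp_apply_apply, map_neg]
    exact (h ψ).symm

theorem eq_of_pair_eq {f g : L2} (h : ∀ ψ, pair ψ f = pair ψ g) : f = g := by
  have := Lp.ker_toTemperedDistributionCLM_eq_bot (E := E3) (F := ℂ) (μ := volume) (p := 2)
  rw [LinearMap.ker_eq_bot'] at this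
  rw [← sub_eq_zero]
  apply this
  ext ψ
  change pair ψ (f - g) = 0
  rw [map_sub, h, sub_self]

/-- The embedding `H¹ → L²`. -/
def toL2CLM : H1 →L[ℂ] L2 := WithLp.fstL 2 ℂ L2 _ ∘L H1.subtypeL

/-- The `i`-th weak partial derivative. -/
def grad (i : Fin 3) : H1 →L[ℂ] L2 :=
  PiLp.proj 2 (fun _ : Fin 3 => L2) i ∘L WithLp.sndL 2 ℂ L2 _ ∘L H1.subtypeL

theorem pair_grad (u : H1) (i : Fin 3) (ψ : 𝓢(E3, ℂ)) :
    pair ψ (grad i u) = - pair (∂_{e i} ψ) (toL2 u) :=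
  (hasWeakGradient_iff _ _).1 u.2 i ψ

/-- The element of `H¹` with a given function and weak gradient. -/
def mkH1 (f : L2) (g : Fin 3 → L2)
    (h : ∀ (i : Fin 3) (ψ : 𝓢(E3, ℂ)), pair ψ (g i) = - pair (∂_{e i} ψ) f) : H1 :=
  ⟨WithLp.toLp 2 (f, WithLp.toLp 2 g), (hasWeakGradient_iff _ _).2 h⟩

@[simp] theorem toL2_mkH1 (f g h) : toL2 (mkH1 f g h) = f := rfl

@[simp] theorem grad_mkH1 (f g h i) : grad i (mkH1 f g h) = g i := rfl

theorem H1_ext_grad {u v : H1} (h0 : toL2 u = toL2 v) (h : ∀ i, grad i u = grad i v) : u = v := by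
  apply Subtype.ext
  apply (WithLp.equiv 2 _).injective
  refine Prod.ext h0 ?_
  apply (WithLp.equiv 2 _).injective
  funext i
  exact h i

theorem H1_ext {u v : H1} (h0 : toL2 u = toL2 v) : u = v :=
  H1_ext_grad h0 fun i => eq_of_pair_eq fun ψ => by rw [pair_grad, pair_grad, h0]

theorem inner_H1 (u v : H1) :
    inner ℂ u v = inner ℂ (toL2 u) (toL2 v) + ∑ i, inner ℂ (grad i u) (grad i v) := by
  rw [Submodule.coe_inner, WithLp.prod_inner_apply, PiLp.inner_apply]
  rfl

theorem norm_sq_H1 (u : H1) : ‖u‖ ^ 2 = ‖toL2 u‖ ^ 2 + ∑ i, ‖grad i u‖ ^ 2 := by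
  have := congrArg Complex.re (inner_H1 u u)
  rw [Complex.add_re, Complex.re_sum] at this
  refine (inner_self_eq_norm_sq (𝕜 := ℂ) u).symm.trans (this.trans ?_)
  simp only [← RCLike.re_eq_complex_re, inner_self_eq_norm_sq]

theorem norm_toL2_le (u : H1) : ‖toL2 u‖ ≤ ‖u‖ := by
  apply le_of_sq_le_sq _ (norm_nonneg _)
  rw [norm_sq_H1 u]
  have : 0 ≤ ∑ i, ‖grad i u‖ ^ 2 := by positivity
  linarith

/-- Each tested form of the weak-gradient condition is a closed condition on the pair, so `H¹` is
closed in the ambient Hilbert space. -/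
instance : CompleteSpace H1 := by
  have : IsClosed (H1 : Set L2Pair) := by
    have : (H1 : Set L2Pair) = ⋂ (i : Fin 3) (ψ : 𝓢(E3, ℂ)),
        {p | pair ψ (p.snd i) = - pair (∂_{e i} ψ) p.fst} := by
      ext p
      simp only [Set.mem_iInter, Set.mem_ofPred_eq]
      exact hasWeakGradient_iff _ _
    rw [this]
    refine isClosed_iInter fun i => isClosed_iInter fun ψ => isClosed_eq ?_ ?_
    · exact (pair ψ ∘L PiLp.proj 2 (fun _ : Fin 3 => L2) i ∘L WithLp.sndL 2 ℂ L2 _).continuous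
    · exact (pair (∂_{e i} ψ) ∘L WithLp.fstL 2 ℂ L2 _).continuous.neg
  exact this.completeSpace_coe

/-! ### Density of Schwartz functions in `H¹` -/

/-- Complex conjugation of Schwartz functions. -/
def conjS (ψ : 𝓢(E3, ℂ)) : 𝓢(E3, ℂ) :=
  ψ.postcompCLM (𝕜 := ℝ) (Complex.conjCLE : ℂ →L[ℝ] ℂ)

@[simp] theorem conjS_apply (ψ : 𝓢(E3, ℂ)) (x : E3) : conjS ψ x = starRingEnd ℂ (ψ x) := rfl

@[simp] theorem conjS_conjS (ψ : 𝓢(E3, ℂ)) : conjS (conjS ψ) = ψ := by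
  ext x; simp

theorem lineDeriv_conjS (ψ : 𝓢(E3, ℂ)) (v : E3) : ∂_{v} (conjS ψ) = conjS (∂_{v} ψ) := by
  ext x
  rw [conjS_apply, SchwartzMap.lineDerivOp_apply_eq_fderiv, SchwartzMap.lineDerivOp_apply_eq_fderiv]
  have := (Complex.conjCLE : ℂ →L[ℝ] ℂ).hasFDerivAt.comp x (ψ.hasFDerivAt x)
  have h2 : (⇑(conjS ψ) : E3 → ℂ) = (Complex.conjCLE : ℂ →L[ℝ] ℂ) ∘ ψ := rfl
  rw [h2, this.fderiv]
  rfl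

/-- Schwartz functions as elements of `L²`. -/
def schwartzL2 (ψ : 𝓢(E3, ℂ)) : L2 := ψ.toLp 2

theorem coeFn_schwartzL2 (ψ : 𝓢(E3, ℂ)) : schwartzL2 ψ =ᵐ[volume] ψ := ψ.coeFn_toLp 2 volume

theorem inner_schwartzL2 (ψ : 𝓢(E3, ℂ)) (f : L2) : inner ℂ (schwartzL2 ψ) f = pair (conjS ψ) f := by
  rw [pair_apply, L2.inner_def]
  apply integral_congr_ae
  filter_upwards [coeFn_schwartzL2 ψ] with x hx
  rw [hx]
  simp [mul_comm]

theorem pair_schwartzL2_lineDeriv (ψ χ : 𝓢(E3, ℂ)) (v : E3) :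
    pair ψ (schwartzL2 (∂_{v} χ)) = - pair (∂_{v} ψ) (schwartzL2 χ) := by
  rw [pair_apply, pair_apply]
  have h1 : ∫ x, ψ x * schwartzL2 (∂_{v} χ) x = ∫ x, ψ x * (∂_{v} χ) x := by
    apply integral_congr_ae
    filter_upwards [coeFn_schwartzL2 (∂_{v} χ)] with x hx
    rw [hx]
  have h2 : ∫ x, (∂_{v} ψ) x * schwartzL2 χ x = ∫ x, (∂_{v} ψ) x * χ x := by
    apply integral_congr_ae
    filter_upwards [coeFn_schwartzL2 χ] with x hx
    rw [hx]
  rw [h1, h2, SchwartzMap.integral_mul_lineDerivOp_right_eq_neg_left]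

/-- Schwartz functions as elements of `H¹`. -/
def ofSchwartz (ψ : 𝓢(E3, ℂ)) : H1 :=
  mkH1 (schwartzL2 ψ) (fun i => schwartzL2 (∂_{e i} ψ)) fun i χ => pair_schwartzL2_lineDeriv χ ψ (e i)

theorem toL2_ofSchwartz (ψ : 𝓢(E3, ℂ)) : toL2 (ofSchwartz ψ) = schwartzL2 ψ := rfl

theorem grad_ofSchwartz (ψ : 𝓢(E3, ℂ)) (i : Fin 3) :
    grad i (ofSchwartz ψ) = schwartzL2 (∂_{e i} ψ) := rfl

theorem laplacian_schwartz (ψ : 𝓢(E3, ℂ)) : Δ ψ = ∑ i, ∂_{e i} (∂_{e i} ψ) := by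
  rw [SchwartzMap.laplacian_eq_sum (EuclideanSpace.basisFun (Fin 3) ℝ)]
  simp

theorem pair_laplacian (ψ : 𝓢(E3, ℂ)) (u : H1) :
    pair (Δ ψ) (toL2 u) = - ∑ i, pair (∂_{e i} ψ) (grad i u) := by
  rw [laplacian_schwartz]
  have : pair (∑ i, ∂_{e i} (∂_{e i} ψ)) (toL2 u) = ∑ i, pair (∂_{e i} (∂_{e i} ψ)) (toL2 u) :=
    map_sum (Lp.toTemperedDistribution (toL2 u)) _ _
  rw [this, ← Finset.sum_neg_distrib]
  exact Finset.sum_congr rfl fun i _ => by rw [pair_grad, neg_neg]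

/-- This is how the `H¹` inner product encodes `1 - Δ`; the conjugate compensates for antilinearity
in the first slot. -/
theorem inner_ofSchwartz (ψ : 𝓢(E3, ℂ)) (u : H1) :
    inner ℂ (ofSchwartz (conjS ψ)) u = pair ψ (toL2 u) - pair (Δ ψ) (toL2 u) := by
  rw [inner_H1, pair_laplacian, toL2_ofSchwartz, inner_schwartzL2, conjS_conjS]
  simp only [grad_ofSchwartz, lineDeriv_conjS, inner_schwartzL2, conjS_conjS]
  ring

theorem exists_sub_laplacian_eq (χ : 𝓢(E3, ℂ)) : ∃ ψ : 𝓢(E3, ℂ), ψ - Δ ψ = χ := by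
  -- The symbol of `(1 - Δ)⁻¹`; the factor `2π` comes from the normalization of the Fourier
  -- transform.
  let m : E3 → ℝ := fun x => (1 + ‖(2 * Real.pi) • x‖ ^ 2) ^ (-1 : ℝ)
  let q : E3 → ℝ := fun x => ‖x‖ ^ 2
  have hm : m.HasTemperateGrowth := by
    have h : (fun x : E3 => (1 + ‖x‖ ^ 2) ^ (-1 : ℝ)).HasTemperateGrowth := by fun_prop
    have h' : (fun x : E3 => (2 * Real.pi) • x).HasTemperateGrowth := by fun_prop
    exact h.comp h'
  have hq : q.HasTemperateGrowth := by fun_prop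
  refine ⟨SchwartzMap.fourierMultiplierCLM ℂ m χ, ?_⟩
  have h1 : SchwartzMap.fourierMultiplierCLM ℂ (fun _ : E3 => (1 : ℝ)) χ = χ := by simp
  rw [SchwartzMap.laplacian_eq_fourierMultiplierCLM]
  change _ - _ • SchwartzMap.fourierMultiplierCLM ℂ q _ = _
  rw [SchwartzMap.fourierMultiplierCLM_fourierMultiplierCLM_apply hq hm, 
    ← _root_.smul_apply, ← SchwartzMap.fourierMultiplierCLM_smul (hq.mul hm), ← sub_eq_zero]
  have h2 : (fun _ : E3 => (1 : ℝ)) = m - (-(2 * Real.pi) ^ 2) • (q * m) := by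
    funext x
    have : (0 : ℝ) < 1 + ‖(2 * Real.pi) • x‖ ^ 2 := by positivity
    simp only [m, q, Pi.sub_apply, Pi.smul_apply, Pi.mul_apply, smul_eq_mul, Real.rpow_neg_one]
    field_simp
    rw [norm_smul, Real.norm_of_nonneg (by positivity)]
    ring
  have h3 : SchwartzMap.fourierMultiplierCLM ℂ (m - (-(2 * Real.pi) ^ 2) • (q * m)) χ = χ := by
    rw [← h2, h1]
  rw [SchwartzMap.fourierMultiplierCLM_apply, SchwartzMap.smulLeftCLM_sub hm (by fun_prop),
    _root_.sub_apply] at h3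
  change FourierTransform.fourierInvCLM ℝ 𝓢(E3, ℂ) (_ - _) = _ at h3
  rw [map_sub] at h3
  exact sub_eq_zero.2 h3

theorem denseRange_of_inner_eq_zero {S X : Type*} [AddCommGroup S] [Module ℂ S]
    [NormedAddCommGroup X] [InnerProductSpace ℂ X] [CompleteSpace X] (f : S → X)
    (hadd : ∀ a b, f (a + b) = f a + f b) (hsmul : ∀ (c : ℂ) a, f (c • a) = c • f a)
    (h : ∀ u, (∀ a, inner ℂ (f a) u = 0) → u = 0) : DenseRange f := by
  let F : S →ₗ[ℂ] X := ⟨⟨f, hadd⟩, hsmul⟩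
  have : Dense (F.range : Set X) := by
    refine Submodule.dense_iff_topologicalClosure_eq_top.2
      ((Submodule.topologicalClosure_eq_top_iff (𝕜 := ℂ)).2 ((Submodule.eq_bot_iff _).2 ?_))
    exact fun u hu => h u fun a => hu (f a) ⟨a, rfl⟩
  exact this

theorem ofSchwartz_add (ψ χ : 𝓢(E3, ℂ)) : ofSchwartz (ψ + χ) = ofSchwartz ψ + ofSchwartz χ :=
  H1_ext (map_add (SchwartzMap.toLpCLM ℂ ℂ 2 (volume : Measure E3)) ψ χ)

theorem ofSchwartz_smul (c : ℂ) (ψ : 𝓢(E3, ℂ)) : ofSchwartz (c • ψ) = c • ofSchwartz ψ :=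
  H1_ext (map_smul (SchwartzMap.toLpCLM ℂ ℂ 2 (volume : Measure E3)) c ψ)

/-- A vector orthogonal to all Schwartz functions annihilates the range of `1 - Δ` on them, which is
every Schwartz function, so it vanishes. -/
theorem denseRange_ofSchwartz : DenseRange ofSchwartz := by
  refine denseRange_of_inner_eq_zero ofSchwartz ofSchwartz_add ofSchwartz_smul fun u hu => ?_
  apply H1_ext
  apply eq_of_pair_eq
  intro χ
  obtain ⟨ψ, rfl⟩ := exists_sub_laplacian_eq χ
  have h := hu (conjS ψ)
  rw [inner_ofSchwartz] at h
  have : pair (ψ - Δ ψ) (toL2 u) = pair ψ (toL2 u) - pair (Δ ψ) (toL2 u) :=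
    map_sub (Lp.toTemperedDistribution (toL2 u)) _ _
  rw [this, h]
  exact (map_zero (pair (ψ - Δ ψ))).symm

/-! ### Hardy's inequality -/

/-- The bounded vector field `(x - y) / (1 + a² |x - y|²)`. -/
def hardyField (a : ℝ) (y : E3) (i : Fin 3) (x : E3) : ℝ :=
  (x i - y i) * (1 + ‖a • (x - y)‖ ^ 2) ^ (-1 : ℝ)

theorem hardyField_hasTemperateGrowth (a : ℝ) (y : E3) (i : Fin 3) :
    (hardyField a y i).HasTemperateGrowth := by
  have h : (fun x : E3 => (1 + ‖x‖ ^ 2) ^ (-1 : ℝ)).HasTemperateGrowth := by fun_prop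
  have h' : (fun x : E3 => a • (x - y)).HasTemperateGrowth := by fun_prop
  have h2 : (fun x : E3 => x i - y i).HasTemperateGrowth := by
    have := (EuclideanSpace.proj (𝕜 := ℝ) i : E3 →L[ℝ] ℝ).hasTemperateGrowth
    exact this.sub (Function.HasTemperateGrowth.const _)
  exact h2.mul (h.comp h')

theorem hardyField_eq (a : ℝ) (y : E3) (i : Fin 3) (x : E3) :
    hardyField a y i x = (x i - y i) * (1 + a ^ 2 * ‖x - y‖ ^ 2)⁻¹ := by
  rw [hardyField, Real.rpow_neg_one, norm_smul, mul_pow, Real.norm_eq_abs, sq_abs]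

theorem lineDeriv_hardyField (a : ℝ) (y : E3) (i : Fin 3) (x : E3) :
    HasLineDerivAt ℝ (hardyField a y i) ((1 + a ^ 2 * ‖x - y‖ ^ 2)⁻¹ -
      2 * a ^ 2 * (x i - y i) ^ 2 * ((1 + a ^ 2 * ‖x - y‖ ^ 2)⁻¹) ^ 2) x (e i) := by
  have hf : ∀ t : ℝ, hardyField a y i (x + t • e i) =
      (x i - y i + t) * (1 + a ^ 2 * (‖x - y‖ ^ 2 + 2 * t * (x i - y i) + t ^ 2))⁻¹ := by
    intro t
    have : ‖x + t • e i - y‖ ^ 2 = ‖x - y‖ ^ 2 + 2 * t * (x i - y i) + t ^ 2 := by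
      rw [show x + t • e i - y = (x - y) + t • e i by abel, norm_add_sq_real, norm_smul,
        inner_smul_right, EuclideanSpace.inner_single_right]
      simp
      ring
    rw [hardyField_eq, this]
    simp
    left
    ring
  unfold HasLineDerivAt
  simp_rw [hf]
  have h1 : HasDerivAt (fun t : ℝ => x i - y i + t) 1 0 := (hasDerivAt_id 0).const_add _
  have h2 : HasDerivAt (fun t : ℝ => 1 + a ^ 2 * (‖x - y‖ ^ 2 + 2 * t * (x i - y i) + t ^ 2))
      (a ^ 2 * (2 * (x i - y i))) 0 := by
    have h3 : HasDerivAt (fun t : ℝ => ‖x - y‖ ^ 2 + 2 * t * (x i - y i) + t ^ 2)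
        (2 * (x i - y i)) 0 := by
      have := ((((hasDerivAt_id (0 : ℝ)).const_mul 2).mul_const (x i - y i)).const_add
        (‖x - y‖ ^ 2)).add ((hasDerivAt_id (0 : ℝ)).pow 2)
      exact this.congr_deriv (by simp)
    exact (h3.const_mul _).const_add _
  have h0 : (1 + a ^ 2 * (‖x - y‖ ^ 2 + 2 * 0 * (x i - y i) + 0 ^ 2)) ≠ 0 := by
    have : 0 < 1 + a ^ 2 * ‖x - y‖ ^ 2 := by positivity
    simpa using this.ne'
  refine (h1.mul (h2.inv h0)).congr_deriv ?_
  have : 1 + a ^ 2 * ‖x - y‖ ^ 2 ≠ 0 := by positivity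
  simp only [mul_zero, zero_mul, add_zero, Pi.inv_apply, ne_eq, OfNat.ofNat_ne_zero,
    not_false_eq_true, zero_pow]
  field_simp
  ring

theorem lineDeriv_smulLeft (b : E3 → ℝ) (hb : b.HasTemperateGrowth) (f : 𝓢(E3, ℂ)) (i : Fin 3)
    (x : E3) (b' : ℝ) (hb' : HasLineDerivAt ℝ b b' x (e i)) :
    (∂_{e i} (SchwartzMap.smulLeftCLM ℂ b f)) x = b' * f x + b x * (∂_{e i} f) x := by
  rw [SchwartzMap.lineDerivOp_apply, SchwartzMap.lineDerivOp_apply,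
    SchwartzMap.smulLeftCLM_apply hb]
  have h2 : HasLineDerivAt ℝ f (lineDeriv ℝ f x (e i)) x (e i) :=
    (f.differentiableAt.lineDifferentiableAt).hasLineDerivAt
  refine HasLineDerivAt.lineDeriv ?_
  unfold HasLineDerivAt at *
  have := hb'.smul h2
  simp at this ⊢
  rw [add_comm] at this
  exact this

theorem integrable_norm_sq (f : 𝓢(E3, ℂ)) : Integrable (fun x => ‖f x‖ ^ 2) :=
  (f.memLp 2 volume).integrable_norm_pow (by norm_num)

theorem integrable_mul_norm_sq {b : E3 → ℝ} (hb : Continuous b) {C : ℝ} (hC : ∀ x, |b x| ≤ C)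
    (f : 𝓢(E3, ℂ)) : Integrable (fun x => b x * ‖f x‖ ^ 2) :=
  (integrable_norm_sq f).bdd_mul hb.aestronglyMeasurable (ae_of_all _ hC)

theorem sq_coord_le (x y : E3) (i : Fin 3) : (x i - y i) ^ 2 ≤ ‖x - y‖ ^ 2 := by
  rw [EuclideanSpace.norm_sq_eq]
  have := Finset.single_le_sum (f := fun i => ‖(x - y) i‖ ^ 2) (fun _ _ => by positivity)
    (Finset.mem_univ i)
  simpa using this

theorem hardy_weight_le (a : ℝ) (x y : E3) (i : Fin 3) :
    a ^ 2 * (x i - y i) ^ 2 * ((1 + a ^ 2 * ‖x - y‖ ^ 2)⁻¹) ^ 2 ≤ 1 := by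
  have h := sq_coord_le x y i
  have h1 : (0 : ℝ) < 1 + a ^ 2 * ‖x - y‖ ^ 2 := by positivity
  rw [inv_pow, ← div_eq_mul_inv, div_le_one (by positivity)]
  have h2 : a ^ 2 * (x i - y i) ^ 2 ≤ a ^ 2 * ‖x - y‖ ^ 2 := by gcongr
  nlinarith

theorem integrable_schwartz_mul (f g : 𝓢(E3, ℂ)) : Integrable (fun x => f x * g x) :=
  (f.memLp 2 volume).integrable_mul (g.memLp 2 volume)

/-- The integrand is the derivative of `b |f|²` in direction `e i`, obtained from integration by
parts between `conj f` and `b f`. -/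
theorem integral_lineDeriv_mul_norm_sq {b b' : E3 → ℝ} (hb : b.HasTemperateGrowth) (i : Fin 3)
    (hb' : ∀ x, HasLineDerivAt ℝ b (b' x) x (e i)) (f : 𝓢(E3, ℂ)) :
    Integrable (fun x => b' x * ‖f x‖ ^ 2 + 2 * b x * (starRingEnd ℂ (f x) * (∂_{e i} f) x).re) ∧
    ∫ x, (b' x * ‖f x‖ ^ 2 + 2 * b x * (starRingEnd ℂ (f x) * (∂_{e i} f) x).re) = 0 := by
  set G := SchwartzMap.smulLeftCLM ℂ b f
  have hG : ∀ x, G x = b x * f x := fun x => by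
    simp [G, SchwartzMap.smulLeftCLM_apply_apply hb]
  have key := SchwartzMap.integral_mul_lineDerivOp_right_eq_neg_left (μ := volume) (conjS f) G (e i)
  have i1 := integrable_schwartz_mul (conjS f) (∂_{e i} G)
  have i2 := integrable_schwartz_mul (∂_{e i} (conjS f)) G
  have hsum : (fun x => b' x * ‖f x‖ ^ 2 + 2 * b x * (starRingEnd ℂ (f x) * (∂_{e i} f) x).re) =
      fun x => (conjS f x * (∂_{e i} G) x + (∂_{e i} (conjS f)) x * G x).re := by
    funext x
    rw [lineDeriv_conjS, lineDeriv_smulLeft b hb f i x _ (hb' x), hG, conjS_apply, conjS_apply,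
      ← Complex.normSq_eq_norm_sq, Complex.normSq_apply]
    simp
    ring
  rw [hsum]
  refine ⟨(i1.add i2).re, ?_⟩
  have h := integral_re (i1.add i2)
  simp only [Pi.add_apply, RCLike.re_eq_complex_re] at h
  rw [h, integral_add i1 i2, key, neg_add_cancel]
  rfl

theorem hardy_coordinate (a : ℝ) (ha : 0 < a) (y : E3) (i : Fin 3) (f : 𝓢(E3, ℂ)) :
    ∫ x, ((1 + a ^ 2 * ‖x - y‖ ^ 2)⁻¹ -
      2 * (a ^ 2 * (x i - y i) ^ 2 * ((1 + a ^ 2 * ‖x - y‖ ^ 2)⁻¹) ^ 2)) * ‖f x‖ ^ 2 ≤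
    ∫ x, (1 / 2 * (a ^ 2 * (x i - y i) ^ 2 * ((1 + a ^ 2 * ‖x - y‖ ^ 2)⁻¹) ^ 2) * ‖f x‖ ^ 2 +
      2 / a ^ 2 * ‖(∂_{e i} f) x‖ ^ 2) := by
  have h1 : ∀ x : E3, 1 + a ^ 2 * ‖x - y‖ ^ 2 ≠ 0 := fun x => by positivity
  have hw : ∀ x : E3, |(1 + a ^ 2 * ‖x - y‖ ^ 2)⁻¹| ≤ 1 := fun x => by
    rw [abs_of_nonneg (by positivity)]
    exact inv_le_one_of_one_le₀ (by nlinarith [mul_nonneg (sq_nonneg a) (sq_nonneg ‖x - y‖)])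
  have hq := fun x => hardy_weight_le a x y i
  have hq0 : ∀ x : E3, 0 ≤ a ^ 2 * (x i - y i) ^ 2 * ((1 + a ^ 2 * ‖x - y‖ ^ 2)⁻¹) ^ 2 :=
    fun x => by positivity
  have hcq : Continuous fun x : E3 =>
      a ^ 2 * (x i - y i) ^ 2 * ((1 + a ^ 2 * ‖x - y‖ ^ 2)⁻¹) ^ 2 := by
    fun_prop (disch := assumption)
  have hcw : Continuous fun x : E3 => (1 + a ^ 2 * ‖x - y‖ ^ 2)⁻¹ := by
    fun_prop (disch := assumption)
  obtain ⟨i3, h3⟩ := integral_lineDeriv_mul_norm_sq (hardyField_hasTemperateGrowth a y i) i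
    (fun x => lineDeriv_hardyField a y i x) f
  have i4 : Integrable fun x =>
      1 / 2 * (a ^ 2 * (x i - y i) ^ 2 * ((1 + a ^ 2 * ‖x - y‖ ^ 2)⁻¹) ^ 2) * ‖f x‖ ^ 2 +
      2 / a ^ 2 * ‖(∂_{e i} f) x‖ ^ 2 := by
    refine Integrable.add ?_ ((integrable_norm_sq (∂_{e i} f)).const_mul _)
    refine integrable_mul_norm_sq (C := 1) (by fun_prop) (fun x => ?_) f
    rw [abs_of_nonneg (by have := hq0 x; positivity)]
    linarith [hq x, hq0 x]
  rw [← zero_add (∫ x, (1 / 2 * _ * _ + _)), ← h3, ← integral_add i3 i4]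
  refine integral_mono ?_ (i3.add i4) fun x => ?_
  · refine integrable_mul_norm_sq (C := 3) (by fun_prop) (fun x => ?_) f
    refine (abs_sub _ _).trans ?_
    rw [abs_of_nonneg (a := 2 * _) (by have := hq0 x; positivity)]
    linarith [hq x, hw x]
  · have hre : |(starRingEnd ℂ (f x) * (∂_{e i} f) x).re| ≤ ‖f x‖ * ‖(∂_{e i} f) x‖ := by
      refine (Complex.abs_re_le_norm _).trans ?_
      simp
    set r := (starRingEnd ℂ (f x) * (∂_{e i} f) x).re
    set w := (1 + a ^ 2 * ‖x - y‖ ^ 2)⁻¹ with hwdef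
    have hb : hardyField a y i x = (x i - y i) * w := hardyField_eq a y i x
    simp only [hb]
    set p := (x i - y i) * w
    have e1 : a ^ 2 * (x i - y i) ^ 2 * w ^ 2 = a ^ 2 * p ^ 2 := by simp only [p]; ring
    have e2 : 2 * a ^ 2 * (x i - y i) ^ 2 * w ^ 2 = 2 * (a ^ 2 * p ^ 2) := by simp only [p]; ring
    rw [e1, e2]
    have h5 : |p * r| ≤ |p| * (‖f x‖ * ‖(∂_{e i} f) x‖) := by
      rw [abs_mul]; gcongr
    -- Young's inequality with the optimal weight: summed over three coordinates it leaves `3 - 2 -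
    -- 1/2 = 1/2` of the weighted mass, hence Hardy's constant `4`.
    have h6 : 2 * (|p| * (‖f x‖ * ‖(∂_{e i} f) x‖)) ≤
        1 / 2 * (a ^ 2 * p ^ 2) * ‖f x‖ ^ 2 + 2 / a ^ 2 * ‖(∂_{e i} f) x‖ ^ 2 := by
      have := sq_nonneg (a * |p| * ‖f x‖ - 2 * (‖(∂_{e i} f) x‖ / a))
      have e3 : 1 / 2 * (a ^ 2 * p ^ 2) * ‖f x‖ ^ 2 + 2 / a ^ 2 * ‖(∂_{e i} f) x‖ ^ 2 =
        1 / 2 * (a * |p| * ‖f x‖ - 2 * (‖(∂_{e i} f) x‖ / a)) ^ 2 +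
          2 * (|p| * (‖f x‖ * ‖(∂_{e i} f) x‖)) := by
        rw [← sq_abs p]
        field_simp
        ring
      linarith
    have h7 := neg_abs_le (p * r)
    linarith

/-- Adding the three coordinate estimates bounds `3 ∫ w |f|² - (5/2) ∫ a² r² w² |f|²`, where `r = |x
- y|` and `w = (1 + a² r²)⁻¹`. Since `a² r² w² ≤ w`, half of `∫ w |f|²` remains on the left. -/
theorem hardy_schwartz_regularized (a : ℝ) (ha : 0 < a) (y : E3) (f : 𝓢(E3, ℂ)) :
    ∫ x, a ^ 2 * (1 + a ^ 2 * ‖x - y‖ ^ 2)⁻¹ * ‖f x‖ ^ 2 ≤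
      4 * ∑ i, ∫ x, ‖(∂_{e i} f) x‖ ^ 2 := by
  have h1 : ∀ x : E3, 1 + a ^ 2 * ‖x - y‖ ^ 2 ≠ 0 := fun x => by positivity
  have hw : ∀ x : E3, |(1 + a ^ 2 * ‖x - y‖ ^ 2)⁻¹| ≤ 1 := fun x => by
    rw [abs_of_nonneg (by positivity)]
    exact inv_le_one_of_one_le₀ (by nlinarith [mul_nonneg (sq_nonneg a) (sq_nonneg ‖x - y‖)])
  have hq := fun i x => hardy_weight_le a x y i
  have hq0 : ∀ i x, 0 ≤ a ^ 2 * (x i - y i) ^ 2 * ((1 + a ^ 2 * ‖x - y‖ ^ 2)⁻¹) ^ 2 :=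
    fun i x => by positivity
  have hcq : ∀ i, Continuous fun x : E3 =>
      a ^ 2 * (x i - y i) ^ 2 * ((1 + a ^ 2 * ‖x - y‖ ^ 2)⁻¹) ^ 2 := by
    intro i
    fun_prop (disch := assumption)
  have hcw : Continuous fun x : E3 => (1 + a ^ 2 * ‖x - y‖ ^ 2)⁻¹ := by
    fun_prop (disch := assumption)
  have iw := integrable_mul_norm_sq hcw hw f
  have iq : ∀ i, Integrable fun x => a ^ 2 * (x i - y i) ^ 2 *
      ((1 + a ^ 2 * ‖x - y‖ ^ 2)⁻¹) ^ 2 * ‖f x‖ ^ 2 := fun i =>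
    integrable_mul_norm_sq (hcq i) (fun x => by rw [abs_of_nonneg (hq0 i x)]; exact hq i x) f
  have hc : ∀ i, (∫ x, (1 + a ^ 2 * ‖x - y‖ ^ 2)⁻¹ * ‖f x‖ ^ 2) -
      5 / 2 * (∫ x, a ^ 2 * (x i - y i) ^ 2 *
        ((1 + a ^ 2 * ‖x - y‖ ^ 2)⁻¹) ^ 2 * ‖f x‖ ^ 2) ≤
      2 / a ^ 2 * ∫ x, ‖(∂_{e i} f) x‖ ^ 2 := by
    intro i
    have h := hardy_coordinate a ha y i f
    have e1 : ∀ x : E3, ((1 + a ^ 2 * ‖x - y‖ ^ 2)⁻¹ - 2 * (a ^ 2 * (x i - y i) ^ 2 *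
        ((1 + a ^ 2 * ‖x - y‖ ^ 2)⁻¹) ^ 2)) * ‖f x‖ ^ 2 = (1 + a ^ 2 * ‖x - y‖ ^ 2)⁻¹ * ‖f x‖ ^ 2 -
        2 * (a ^ 2 * (x i - y i) ^ 2 * ((1 + a ^ 2 * ‖x - y‖ ^ 2)⁻¹) ^ 2 * ‖f x‖ ^ 2) :=
      fun x => by ring
    simp only [e1, mul_assoc (1 / 2 : ℝ)] at h
    rw [integral_sub iw ((iq i).const_mul 2), integral_const_mul, integral_add
      ((iq i).const_mul (1 / 2)) ((integrable_norm_sq (∂_{e i} f)).const_mul _),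
      integral_const_mul, integral_const_mul] at h
    linarith
  have hs := Finset.sum_le_sum fun i (_ : i ∈ Finset.univ) => hc i
  rw [Finset.sum_sub_distrib, ← Finset.mul_sum, ← Finset.mul_sum, ← integral_finsetSum _
    fun i _ => iq i] at hs
  simp only [Finset.sum_const, Finset.card_univ, Fintype.card_fin, nsmul_eq_mul] at hs
  have hsum : ∀ x : E3, ∑ i, a ^ 2 * (x i - y i) ^ 2 *
      ((1 + a ^ 2 * ‖x - y‖ ^ 2)⁻¹) ^ 2 * ‖f x‖ ^ 2 ≤ (1 + a ^ 2 * ‖x - y‖ ^ 2)⁻¹ * ‖f x‖ ^ 2 := by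
    intro x
    rw [← Finset.sum_mul, ← Finset.sum_mul, ← Finset.mul_sum]
    gcongr
    have : ∑ i, (x i - y i) ^ 2 = ‖x - y‖ ^ 2 := by
      rw [EuclideanSpace.norm_sq_eq]; simp
    rw [this, sq (_⁻¹), ← mul_assoc]
    have h2 : 0 < 1 + a ^ 2 * ‖x - y‖ ^ 2 := by positivity
    have h3 : a ^ 2 * ‖x - y‖ ^ 2 * (1 + a ^ 2 * ‖x - y‖ ^ 2)⁻¹ ≤ 1 := by
      rw [← div_eq_mul_inv, div_le_one h2]; linarith
    exact mul_le_of_le_one_left (by positivity) h3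
  have hmono := integral_mono (integrable_finsetSum _ fun i _ => iq i) iw hsum
  simp only [mul_assoc (a ^ 2) (_⁻¹)]
  rw [integral_const_mul]
  have ha2 : 0 < a ^ 2 := by positivity
  have h8 : 1 / 2 * (∫ x, (1 + a ^ 2 * ‖x - y‖ ^ 2)⁻¹ * ‖f x‖ ^ 2) ≤
      2 / a ^ 2 * ∑ i, ∫ x, ‖(∂_{e i} f) x‖ ^ 2 := by
    push_cast at hs
    linarith
  rw [div_mul_eq_mul_div 2 (a ^ 2), le_div_iff₀ ha2] at h8
  linarith

theorem fatou_real {α : Type*} [MeasurableSpace α] {μ : Measure α} {G : ℕ → α → ℝ} {g : α → ℝ}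
    {c : ℕ → ℝ} {C : ℝ} (hG : ∀ n, Integrable (G n) μ) (h0 : ∀ n x, 0 ≤ G n x)
    (hlim : ∀ᵐ x ∂μ, Tendsto (fun n => G n x) atTop (𝓝 (g x)))
    (hc : ∀ n, ∫ x, G n x ∂μ ≤ c n) (hcC : Tendsto c atTop (𝓝 C)) :
    Integrable g μ ∧ ∫ x, g x ∂μ ≤ C := by
  have hgm : AEStronglyMeasurable g μ :=
    aestronglyMeasurable_of_tendsto_ae atTop (fun n => (hG n).aestronglyMeasurable) hlim
  have hg0 : 0 ≤ᵐ[μ] g := by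
    filter_upwards [hlim] with x hx
    exact ge_of_tendsto' hx fun n => h0 n x
  have hC : 0 ≤ C := ge_of_tendsto' hcC fun n => (integral_nonneg (h0 n)).trans (hc n)
  have key : ∫⁻ x, ENNReal.ofReal (g x) ∂μ ≤ ENNReal.ofReal C := by
    calc ∫⁻ x, ENNReal.ofReal (g x) ∂μ
        = ∫⁻ x, liminf (fun n => ENNReal.ofReal (G n x)) atTop ∂μ := by
          apply lintegral_congr_ae
          filter_upwards [hlim] with x hx
          exact ((ENNReal.tendsto_ofReal hx).liminf_eq).symm
      _ ≤ liminf (fun n => ∫⁻ x, ENNReal.ofReal (G n x) ∂μ) atTop :=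
          lintegral_liminf_le' fun n => (hG n).aestronglyMeasurable.aemeasurable.ennreal_ofReal
      _ ≤ liminf (fun n => ENNReal.ofReal (c n)) atTop := by
          refine liminf_le_liminf (Eventually.of_forall fun n => ?_)
          rw [← ofReal_integral_eq_lintegral_ofReal (hG n) (ae_of_all _ (h0 n))]
          exact ENNReal.ofReal_le_ofReal (hc n)
      _ = ENNReal.ofReal C := (ENNReal.tendsto_ofReal hcC).liminf_eq
  have hgi : Integrable g μ := by
    refine ⟨hgm, ?_⟩
    rw [hasFiniteIntegral_iff_ofReal hg0]
    exact key.trans_lt ENNReal.ofReal_lt_top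
  refine ⟨hgi, ?_⟩
  rwa [← ofReal_integral_eq_lintegral_ofReal hgi hg0, ENNReal.ofReal_le_ofReal_iff hC] at key

theorem norm_sq_L2 (f : L2) : ‖f‖ ^ 2 = ∫ x, ‖f x‖ ^ 2 := by
  have h := L2.inner_def (𝕜 := ℂ) f f
  rw [inner_self_eq_norm_sq_to_K] at h
  have h2 : ∀ x, inner ℂ (f x) (f x) = ((‖f x‖ ^ 2 : ℝ) : ℂ) := fun x => by
    rw [inner_self_eq_norm_sq_to_K]; simp
  simp only [h2] at h
  rw [integral_complex_ofReal] at h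
  exact Complex.ofReal_injective (by rw [Complex.ofReal_pow]; exact h)

theorem norm_sq_schwartzL2 (f : 𝓢(E3, ℂ)) : ‖schwartzL2 f‖ ^ 2 = ∫ x, ‖f x‖ ^ 2 := by
  rw [norm_sq_L2]
  apply integral_congr_ae
  filter_upwards [coeFn_schwartzL2 f] with x hx
  rw [hx]

/-- Fatou's lemma with `a = n + 1 → ∞`, since `a² / (1 + a² r²) → r⁻²` off the null set `x = y`. -/
theorem hardy_schwartz (y : E3) (f : 𝓢(E3, ℂ)) :
    Integrable (fun x => (‖x - y‖⁻¹) ^ 2 * ‖f x‖ ^ 2) ∧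
    ∫ x, (‖x - y‖⁻¹) ^ 2 * ‖f x‖ ^ 2 ≤ 4 * ‖ofSchwartz f‖ ^ 2 := by
  have h1 : ∀ (a : ℝ) (x : E3), 1 + a ^ 2 * ‖x - y‖ ^ 2 ≠ 0 := fun a x => by positivity
  refine fatou_real (G := fun (n : ℕ) x =>
    (n + 1 : ℝ) ^ 2 * (1 + (n + 1 : ℝ) ^ 2 * ‖x - y‖ ^ 2)⁻¹ * ‖f x‖ ^ 2)
    (c := fun _ => 4 * ‖ofSchwartz f‖ ^ 2) (fun n => ?_) (fun n x => by positivity) ?_ (fun n => ?_)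
    tendsto_const_nhds
  · have hc : Continuous fun x : E3 => (n + 1 : ℝ) ^ 2 * (1 + (n + 1 : ℝ) ^ 2 * ‖x - y‖ ^ 2)⁻¹ := by
      have := h1 (n + 1)
      fun_prop (disch := assumption)
    refine integrable_mul_norm_sq hc (C := (n + 1 : ℝ) ^ 2) (fun x => ?_) f
    rw [abs_of_nonneg (by positivity)]
    refine mul_le_of_le_one_right (by positivity) (inv_le_one_of_one_le₀ ?_)
    have : 0 ≤ (n + 1 : ℝ) ^ 2 * ‖x - y‖ ^ 2 := by positivity
    linarith
  · have hne : ∀ᵐ x : E3, x ≠ y := by simp [ae_iff, Set.ofPred_eq_eq_singleton]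
    filter_upwards [hne] with x hx
    refine Tendsto.mul_const _ ?_
    have hr : ‖x - y‖ ^ 2 ≠ 0 := by
      have := norm_ne_zero_iff.2 (sub_ne_zero.2 hx)
      positivity
    have h2 : ∀ n : ℕ, (n + 1 : ℝ) ^ 2 * (1 + (n + 1 : ℝ) ^ 2 * ‖x - y‖ ^ 2)⁻¹ =
        ((1 / ((n : ℝ) + 1)) ^ 2 + ‖x - y‖ ^ 2)⁻¹ := by
      intro n
      have := h1 (n + 1) x
      have : (n + 1 : ℝ) ≠ 0 := by positivity
      field_simp
    simp only [h2]
    have h3 := ((tendsto_one_div_add_atTop_nhds_zero_nat (𝕜 := ℝ)).pow 2).add_const (‖x - y‖ ^ 2)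
    have h4 := h3.inv₀ (by simpa using hr)
    convert h4 using 2
    simp
  · refine (hardy_schwartz_regularized (n + 1) (by positivity) y f).trans ?_
    rw [norm_sq_H1]
    simp only [grad_ofSchwartz, norm_sq_schwartzL2]
    have := sq_nonneg ‖toL2 (ofSchwartz f)‖
    linarith

theorem exists_schwartz_seq (u : H1) : ∃ f : ℕ → 𝓢(E3, ℂ),
    Tendsto (fun n => ofSchwartz (f n)) atTop (𝓝 u) ∧
    ∀ᵐ x, Tendsto (fun n => f n x) atTop (𝓝 (toL2 u x)) := by
  obtain ⟨v, hv, hvu⟩ := mem_closure_iff_seq_limit.1 (denseRange_ofSchwartz u)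
  choose f hf using hv
  have h1 : Tendsto (fun n => toL2CLM (v n)) atTop (𝓝 (toL2CLM u)) :=
    (toL2CLM.continuous.tendsto u).comp hvu
  obtain ⟨ns, hns, hlim⟩ := (tendstoInMeasure_of_tendsto_Lp h1).exists_seq_tendsto_ae
  refine ⟨fun n => f (ns n), ?_, ?_⟩
  · simp only [hf]
    exact hvu.comp hns.tendsto_atTop
  · have h2 : ∀ᵐ x, ∀ n, schwartzL2 (f n) x = f n x :=
      ae_all_iff.2 fun n => coeFn_schwartzL2 (f n)
    filter_upwards [hlim, h2] with x hx hx2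
    refine hx.congr fun n => ?_
    rw [← hx2, ← hf]
    rfl

/-- Schwartz approximants converging both in `H¹` and almost everywhere carry the inequality over by
Fatou. -/
theorem hardy (y : E3) (u : H1) :
    Integrable (fun x => (‖x - y‖⁻¹) ^ 2 * ‖toL2 u x‖ ^ 2) ∧
    ∫ x, (‖x - y‖⁻¹) ^ 2 * ‖toL2 u x‖ ^ 2 ≤ 4 * ‖u‖ ^ 2 := by
  obtain ⟨f, hf, hlim⟩ := exists_schwartz_seq u
  refine fatou_real (G := fun n x => (‖x - y‖⁻¹) ^ 2 * ‖f n x‖ ^ 2)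
    (c := fun n => 4 * ‖ofSchwartz (f n)‖ ^ 2) (fun n => (hardy_schwartz y (f n)).1)
    (fun n x => by positivity) ?_ (fun n => (hardy_schwartz y (f n)).2) ((hf.norm.pow 2).const_mul 4)
  filter_upwards [hlim] with x hx
  exact (hx.norm.pow 2).const_mul _

/-! ### Bounded Lipschitz functions as multipliers of `H¹` -/

/-- `Ω` is bounded by `K` and Lipschitz with constant `K`. -/
structure BddLip (Ω : E3 → ℝ) (K : ℝ) : Prop where
  bound : ∀ x, |Ω x| ≤ K
  lip : ∀ x y, |Ω x - Ω y| ≤ K * ‖x - y‖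

theorem BddLip.nonneg {Ω : E3 → ℝ} {K : ℝ} (h : BddLip Ω K) : 0 ≤ K :=
  (abs_nonneg _).trans (h.bound 0)

theorem BddLip.lipschitzWith {Ω : E3 → ℝ} {K : ℝ} (h : BddLip Ω K) :
    LipschitzWith ⟨K, h.nonneg⟩ Ω :=
  LipschitzWith.of_dist_le_mul fun x y => by
    rw [Real.dist_eq, dist_eq_norm]; exact h.lip x y

theorem BddLip.continuous {Ω : E3 → ℝ} {K : ℝ} (h : BddLip Ω K) : Continuous Ω :=
  h.lipschitzWith.continuous

theorem norm_e (i : Fin 3) : ‖e i‖ = 1 := by simp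

theorem BddLip.abs_lineDeriv_le {Ω : E3 → ℝ} {K : ℝ} (h : BddLip Ω K) (i : Fin 3) (x : E3) :
    |lineDeriv ℝ Ω x (e i)| ≤ K := by
  have := norm_lineDeriv_le_of_lipschitz (𝕜 := ℝ) (v := e i) (x₀ := x) h.lipschitzWith
  rwa [norm_e, mul_one] at this

theorem BddLip.measurable_lineDeriv {Ω : E3 → ℝ} {K : ℝ} (h : BddLip Ω K) (i : Fin 3) :
    Measurable fun x => lineDeriv ℝ Ω x (e i) :=
  _root_.measurable_lineDeriv h.continuous

/-- Supplies a dominating function uniform over translations of length at most `1`; the exponent `4`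
exceeds the dimension `3`, so it is integrable. -/
theorem schwartz_translate_bound (g : 𝓢(E3, ℂ)) : ∃ C : ℝ, ∀ x y : E3, ‖y‖ ≤ 1 →
    ‖g (x + y)‖ ≤ C * (1 + ‖x‖) ^ (-(4 : ℝ)) := by
  obtain ⟨C0, -, h0⟩ := g.decay 0 0
  obtain ⟨C1, -, h1⟩ := g.decay 4 0
  refine ⟨8 * (16 * C0 + C1), fun x y hy => ?_⟩
  have h0 := h0 (x + y)
  have h1 := h1 (x + y)
  simp only [norm_iteratedFDeriv_zero, pow_zero, one_mul] at h0 h1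
  have hx : 1 + ‖x‖ ≤ 2 + ‖x + y‖ := by
    have : ‖x‖ ≤ ‖x + y‖ + ‖y‖ := by
      simpa using norm_sub_le (x + y) y
    linarith
  have hp : (0 : ℝ) < (1 + ‖x‖) ^ 4 := by positivity
  rw [Real.rpow_neg (by positivity), ← div_eq_mul_inv]
  have : ((1 + ‖x‖) ^ (4 : ℝ)) = (1 + ‖x‖) ^ (4 : ℕ) := by
    exact_mod_cast Real.rpow_natCast (1 + ‖x‖) 4
  rw [this, le_div_iff₀ hp]
  have h2 : (1 + ‖x‖) ^ 4 ≤ (2 + ‖x + y‖) ^ 4 := by gcongr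
  have h3 : (2 + ‖x + y‖) ^ 4 ≤ 2 ^ (4 - 1) * (2 ^ 4 + ‖x + y‖ ^ 4) :=
    add_pow_le (by norm_num) (norm_nonneg _) 4
  calc ‖g (x + y)‖ * (1 + ‖x‖) ^ 4 ≤ ‖g (x + y)‖ * (2 ^ (4 - 1) * (2 ^ 4 + ‖x + y‖ ^ 4)) := by
        gcongr; exact h2.trans h3
    _ = 8 * (16 * ‖g (x + y)‖ + ‖x + y‖ ^ 4 * ‖g (x + y)‖) := by ring
    _ ≤ 8 * (16 * C0 + C1) := by gcongr

theorem schwartz_hasDerivAt_sub (χ : 𝓢(E3, ℂ)) (x v : E3) (s : ℝ) :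
    HasDerivAt (fun s : ℝ => χ (x - s • v)) (-(∂_{v} χ) (x - s • v)) s := by
  have h1 : HasDerivAt (fun s : ℝ => x - s • v) (-v) s := by
    have := ((hasDerivAt_id s).smul_const v).const_sub x
    simpa using this
  have := (χ.hasFDerivAt (x - s • v)).comp_hasDerivAt s h1
  rw [SchwartzMap.lineDerivOp_apply_eq_fderiv, ← map_neg]
  exact this

theorem hasDerivAt_integral_translate {Ω : E3 → ℝ} {K : ℝ} (h : BddLip Ω K) (χ : 𝓢(E3, ℂ))
    (i : Fin 3) : HasDerivAt (fun s : ℝ => ∫ x, (Ω x : ℂ) * χ (x - s • e i))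
      (-∫ x, (Ω x : ℂ) * (∂_{e i} χ) x) 0 := by
  obtain ⟨C, hC⟩ := schwartz_translate_bound (∂_{e i} χ)
  have hΩ : Continuous fun x => (Ω x : ℂ) := Complex.continuous_ofReal.comp h.continuous
  have hb : ∀ x, ‖(Ω x : ℂ)‖ ≤ K := fun x => by
    rw [Complex.norm_real]; exact h.bound x
  have := (hasDerivAt_integral_of_dominated_loc_of_deriv_le (μ := (volume : Measure E3)) (𝕜 := ℝ)
    (F := fun s x => (Ω x : ℂ) * χ (x - s • e i)) (x₀ := 0) (s := Metric.ball 0 1)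
    (F' := fun s x => (Ω x : ℂ) * (-(∂_{e i} χ) (x - s • e i)))
    (bound := fun x => K * (C * (1 + ‖x‖) ^ (-(4 : ℝ)))) (Metric.ball_mem_nhds _ one_pos)
    ?_ ?_ ?_ ?_ ?_ ?_).2
  · simpa [integral_neg] using this
  · refine Eventually.of_forall fun s => Continuous.aestronglyMeasurable ?_
    exact hΩ.mul (χ.continuous.comp (by fun_prop))
  · simp only [zero_smul, sub_zero]
    exact χ.integrable.bdd_mul hΩ.aestronglyMeasurable (ae_of_all _ hb)
  · simp only [zero_smul, sub_zero]
    exact (hΩ.mul (∂_{e i} χ).continuous.neg).aestronglyMeasurable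
  · refine ae_of_all _ fun x s hs => ?_
    rw [norm_mul, norm_neg, sub_eq_add_neg]
    have hs' : ‖-(s • e i)‖ ≤ 1 := by
      rw [norm_neg, norm_smul, norm_e, mul_one]
      exact (mem_ball_zero_iff.1 hs).le
    exact mul_le_mul (hb x) (hC x _ hs') (norm_nonneg _) h.nonneg
  · refine ((integrable_one_add_norm ?_).const_mul _).const_mul _
    simp
    norm_num
  · exact ae_of_all _ fun x s _ => (schwartz_hasDerivAt_sub χ x (e i) s).const_mul _

/-- Translation invariance moves difference quotients from `Ω` to `χ`. On the `Ω` side they converge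
almost everywhere by Rademacher's theorem, dominated through the Lipschitz bound; on the `χ` side by
differentiation under the integral. -/
theorem integral_lineDeriv_mul_schwartz {Ω : E3 → ℝ} {K : ℝ} (h : BddLip Ω K) (χ : 𝓢(E3, ℂ))
    (i : Fin 3) : ∫ x, ((lineDeriv ℝ Ω x (e i) : ℝ) : ℂ) * χ x =
      -∫ x, (Ω x : ℂ) * (∂_{e i} χ) x := by
  let t : ℕ → ℝ := fun n => 1 / ((n : ℝ) + 1)
  have ht : Tendsto t atTop (𝓝[≠] 0) := by
    refine tendsto_nhdsWithin_iff.2 ⟨tendsto_one_div_add_atTop_nhds_zero_nat, ?_⟩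
    exact Eventually.of_forall fun n => (by positivity : (0 : ℝ) < 1 / ((n : ℝ) + 1)).ne'
  have hΩ : Continuous fun x => (Ω x : ℂ) := Complex.continuous_ofReal.comp h.continuous
  have hb : ∀ x, ‖(Ω x : ℂ)‖ ≤ K := fun x => by
    rw [Complex.norm_real]; exact h.bound x
  have h1 := (hasDerivAt_integral_translate h χ i).tendsto_slope_zero.comp ht
  have h2 : Tendsto (fun n => ∫ x, (((t n)⁻¹ * (Ω (x + t n • e i) - Ω x) : ℝ) : ℂ) * χ x) atTop
      (𝓝 (∫ x, ((lineDeriv ℝ Ω x (e i) : ℝ) : ℂ) * χ x)) := by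
    refine tendsto_integral_of_dominated_convergence (fun x => K * ‖χ x‖) (fun n => ?_)
      (χ.integrable.norm.const_mul K) (fun n => ae_of_all _ fun x => ?_) ?_
    · refine Continuous.aestronglyMeasurable ?_
      have := h.continuous
      fun_prop
    · rw [norm_mul, Complex.norm_real, Real.norm_eq_abs, abs_mul, abs_inv]
      gcongr
      have h3 := h.lip (x + t n • e i) x
      rw [add_sub_cancel_left, norm_smul, norm_e, mul_one, Real.norm_eq_abs] at h3
      have h4 : 0 < |t n| := abs_pos.2 (by positivity : (0 : ℝ) < 1 / ((n : ℝ) + 1)).ne'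
      rw [inv_mul_le_iff₀ h4, mul_comm |t n|]
      exact h3
    · filter_upwards [h.lipschitzWith.ae_lineDifferentiableAt (μ := volume) (e i)] with x hx
      refine Tendsto.mul_const _ ?_
      refine (Complex.continuous_ofReal.tendsto _).comp ?_
      exact hx.hasLineDerivAt.tendsto_slope_zero.comp ht
  refine tendsto_nhds_unique h2 (h1.congr fun n => ?_)
  have i1 : ∀ s : ℝ, Integrable fun x => (Ω x : ℂ) * χ (x - s • e i) := fun s =>
    (χ.integrable.comp_sub_right (s • e i)).bdd_mul hΩ.aestronglyMeasurable (ae_of_all _ hb)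
  have i2 : Integrable fun x => (Ω x : ℂ) * χ x :=
    χ.integrable.bdd_mul hΩ.aestronglyMeasurable (ae_of_all _ hb)
  have i3 : Integrable fun x => (Ω (x + t n • e i) : ℂ) * χ x := by
    refine χ.integrable.bdd_mul (c := K) ?_ (ae_of_all _ fun x => hb _)
    exact (hΩ.comp (by fun_prop)).aestronglyMeasurable
  have e1 : ∫ x, (Ω (x + t n • e i) : ℂ) * χ x = ∫ x, (Ω x : ℂ) * χ (x - t n • e i) := by
    rw [← integral_sub_right_eq_self _ (t n • e i)]
    simp
  simp only [Function.comp_apply, zero_add, zero_smul, sub_zero]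
  rw [← e1, ← integral_sub i3 i2, ← integral_smul]
  refine integral_congr_ae (ae_of_all _ fun x => ?_)
  simp
  ring

theorem memLp_mul {m : E3 → ℝ} {K : ℝ} (hm : AEStronglyMeasurable m) (hK : ∀ x, |m x| ≤ K)
    (f : L2) : MemLp (fun x => (m x : ℂ) * f x) 2 :=
  (Lp.memLp f).of_le_mul (c := K)
    ((Complex.continuous_ofReal.comp_aestronglyMeasurable hm).mul (Lp.aestronglyMeasurable f))
    (ae_of_all _ fun x => by
      rw [norm_mul, Complex.norm_real]; gcongr; exact hK x)

/-- Multiplication by a bounded real function on `L²`. -/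
def mulL2 {m : E3 → ℝ} {K : ℝ} (hm : AEStronglyMeasurable m) (hK : ∀ x, |m x| ≤ K) :
    L2 →L[ℂ] L2 :=
  LinearMap.mkContinuous
    { toFun := fun f => (memLp_mul hm hK f).toLp
      map_add' := fun f g => by
        apply Lp.ext
        filter_upwards [(memLp_mul hm hK (f + g)).coeFn_toLp, Lp.coeFn_add f g,
          Lp.coeFn_add (memLp_mul hm hK f).toLp (memLp_mul hm hK g).toLp,
          (memLp_mul hm hK f).coeFn_toLp, (memLp_mul hm hK g).coeFn_toLp] with x h1 h2 h3 h4 h5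
        simp only [h1, h2, h3, h4, h5, Pi.add_apply, mul_add]
      map_smul' := fun c f => by
        apply Lp.ext
        filter_upwards [(memLp_mul hm hK (c • f)).coeFn_toLp, Lp.coeFn_smul c f,
          Lp.coeFn_smul c (memLp_mul hm hK f).toLp, (memLp_mul hm hK f).coeFn_toLp]
          with x h1 h2 h3 h4
        simp only [h1, h2, h3, h4, Pi.smul_apply, smul_eq_mul, RingHom.id_apply]
        ring } K fun f => Lp.norm_le_mul_norm_of_ae_le_mul (by
      filter_upwards [(memLp_mul hm hK f).coeFn_toLp] with x hx
      simp only [LinearMap.coe_mk, AddHom.coe_mk, hx]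
      rw [norm_mul, Complex.norm_real]; gcongr; exact hK x)

theorem coeFn_mulL2 {m : E3 → ℝ} {K : ℝ} (hm : AEStronglyMeasurable m) (hK : ∀ x, |m x| ≤ K)
    (f : L2) : mulL2 hm hK f =ᵐ[volume] fun x => (m x : ℂ) * f x :=
  (memLp_mul hm hK f).coeFn_toLp

theorem norm_mulL2_le {m : E3 → ℝ} {K : ℝ} (hm : AEStronglyMeasurable m) (hK : ∀ x, |m x| ≤ K)
    (f : L2) : ‖mulL2 hm hK f‖ ≤ K * ‖f‖ :=
  Lp.norm_le_mul_norm_of_ae_le_mul (by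
      filter_upwards [coeFn_mulL2 hm hK f] with x hx
      rw [hx, norm_mul, Complex.norm_real]; gcongr; exact hK x)

theorem pair_mulL2_schwartz {m : E3 → ℝ} {K : ℝ} (hm : AEStronglyMeasurable m)
    (hK : ∀ x, |m x| ≤ K) (ψ f : 𝓢(E3, ℂ)) :
    pair ψ (mulL2 hm hK (schwartzL2 f)) = ∫ x, (m x : ℂ) * (ψ x * f x) := by
  rw [pair_apply]
  apply integral_congr_ae
  filter_upwards [coeFn_mulL2 hm hK (schwartzL2 f), coeFn_schwartzL2 f] with x h1 h2
  rw [h1, h2]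
  ring

/-- The product of two Schwartz functions. -/
def mulS (ψ f : 𝓢(E3, ℂ)) : 𝓢(E3, ℂ) := SchwartzMap.pairing (ContinuousLinearMap.mul ℂ ℂ) ψ f

theorem mulS_apply (ψ f : 𝓢(E3, ℂ)) (x : E3) : mulS ψ f x = ψ x * f x := rfl

theorem lineDeriv_mulS (ψ f : 𝓢(E3, ℂ)) (v x : E3) :
    (∂_{v} (mulS ψ f)) x = (∂_{v} ψ) x * f x + ψ x * (∂_{v} f) x := by
  simp only [SchwartzMap.lineDerivOp_apply_eq_fderiv]
  have : (⇑(mulS ψ f) : E3 → ℂ) = ψ * f := rfl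
  rw [this, fderiv_mul ψ.differentiableAt f.differentiableAt]
  simp
  ring

/-- The weak gradient is given by the product rule. The squared norm is at most `7 K² ‖u‖²_{L²} + 2
K² ‖∇u‖²_{L²}`, whence the factor `3`. -/
theorem BddLip.exists_mul {Ω : E3 → ℝ} {K : ℝ} (h : BddLip Ω K) (u : H1) :
    ∃ w : H1, toL2 w =ᵐ[volume] (fun x => (Ω x : ℂ) * toL2 u x) ∧ ‖w‖ ≤ 3 * K * ‖u‖ := by
  have hm := h.continuous.aestronglyMeasurable (μ := (volume : Measure E3))
  have hm' := fun i => (h.measurable_lineDeriv i).aestronglyMeasurable (μ := (volume : Measure E3))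
  set A := mulL2 hm h.bound
  set B := fun i => mulL2 (hm' i) (h.abs_lineDeriv_le i)
  have key : ∀ (i : Fin 3) (ψ : 𝓢(E3, ℂ)),
      pair ψ (B i (toL2 u) + A (grad i u)) = -pair (∂_{e i} ψ) (A (toL2 u)) := by
    intro i ψ
    -- Both sides are continuous in `u` for the `H¹` norm, so Schwartz `u` suffice.
    refine denseRange_ofSchwartz.induction_on (p := fun u =>
      pair ψ (B i (toL2 u) + A (grad i u)) = -pair (∂_{e i} ψ) (A (toL2 u))) u ?_ fun f => ?_
    · refine isClosed_eq ?_ ?_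
      · exact (pair ψ).continuous.comp (((B i).continuous.comp toL2CLM.continuous).add
          (A.continuous.comp (grad i).continuous))
      · exact ((pair (∂_{e i} ψ)).continuous.comp (A.continuous.comp toL2CLM.continuous)).neg
    · rw [map_add, toL2_ofSchwartz, grad_ofSchwartz, pair_mulL2_schwartz, pair_mulL2_schwartz,
        pair_mulL2_schwartz]
      have h1 := integral_lineDeriv_mul_schwartz h (mulS ψ f) i
      have hb : ∀ x, ‖(Ω x : ℂ)‖ ≤ K := fun x => by
        rw [Complex.norm_real]; exact h.bound x
      have hi : ∀ a b : 𝓢(E3, ℂ), Integrable fun x => (Ω x : ℂ) * (a x * b x) := fun a b =>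
        (integrable_schwartz_mul a b).bdd_mul
          (Complex.continuous_ofReal.comp_aestronglyMeasurable hm) (ae_of_all _ hb)
      simp only [mulS_apply, lineDeriv_mulS, mul_add] at h1
      rw [integral_add (hi _ _) (hi _ _)] at h1
      rw [h1]
      ring
  refine ⟨mkH1 (A (toL2 u)) _ key, coeFn_mulL2 hm h.bound _, ?_⟩
  have hK := h.nonneg
  refine le_of_sq_le_sq ?_ (by positivity)
  have h0 : ‖A (toL2 u)‖ ≤ K * ‖toL2 u‖ := norm_mulL2_le _ _ _
  have hi : ∀ i, ‖B i (toL2 u) + A (grad i u)‖ ≤ K * ‖toL2 u‖ + K * ‖grad i u‖ := fun i =>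
    (norm_add_le _ _).trans (add_le_add (norm_mulL2_le _ _ _) (norm_mulL2_le _ _ _))
  have hi' : ∀ i, ‖B i (toL2 u) + A (grad i u)‖ ^ 2 ≤
      2 * K ^ 2 * (‖toL2 u‖ ^ 2 + ‖grad i u‖ ^ 2) := fun i => by
    have h2 : ‖B i (toL2 u) + A (grad i u)‖ ^ 2 ≤ (K * ‖toL2 u‖ + K * ‖grad i u‖) ^ 2 := by
      gcongr; exact hi i
    nlinarith [sq_nonneg (K * ‖toL2 u‖ - K * ‖grad i u‖)]
  have h0' : ‖A (toL2 u)‖ ^ 2 ≤ K ^ 2 * ‖toL2 u‖ ^ 2 := by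
    rw [← mul_pow]; gcongr
  rw [norm_sq_H1, mul_pow, norm_sq_H1]
  simp only [toL2_mkH1, grad_mkH1, Fin.sum_univ_three]
  have := mul_nonneg (sq_nonneg K) (sq_nonneg ‖toL2 u‖)
  have := fun i => mul_nonneg (sq_nonneg K) (sq_nonneg ‖grad i u‖)
  nlinarith [hi' 0, hi' 1, hi' 2, this 0, this 1, this 2]

theorem BddLip.add {Ω₁ Ω₂ : E3 → ℝ} {K₁ K₂ : ℝ} (h₁ : BddLip Ω₁ K₁) (h₂ : BddLip Ω₂ K₂) :
    BddLip (fun x => Ω₁ x + Ω₂ x) (K₁ + K₂) where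
  bound x := (abs_add_le _ _).trans (add_le_add (h₁.bound x) (h₂.bound x))
  lip x y := by
    rw [add_sub_add_comm, add_mul]
    exact (abs_add_le _ _).trans (add_le_add (h₁.lip x y) (h₂.lip x y))

theorem BddLip.mul {Ω₁ Ω₂ : E3 → ℝ} {K₁ K₂ : ℝ} (h₁ : BddLip Ω₁ K₁) (h₂ : BddLip Ω₂ K₂) :
    BddLip (fun x => Ω₁ x * Ω₂ x) (2 * (K₁ * K₂)) where
  bound x := by
    have := mul_le_mul (h₁.bound x) (h₂.bound x) (abs_nonneg _) h₁.nonneg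
    rw [abs_mul]
    linarith [mul_nonneg h₁.nonneg h₂.nonneg]
  lip x y := by
    have e1 : Ω₁ x * Ω₂ x - Ω₁ y * Ω₂ y = Ω₁ x * (Ω₂ x - Ω₂ y) + (Ω₁ x - Ω₁ y) * Ω₂ y := by ring
    rw [e1]
    refine (abs_add_le _ _).trans ?_
    rw [abs_mul, abs_mul]
    have := mul_le_mul (h₁.bound x) (h₂.lip x y) (abs_nonneg _) h₁.nonneg
    have := mul_le_mul (h₁.lip x y) (h₂.bound y) (abs_nonneg _)
      (mul_nonneg h₁.nonneg (norm_nonneg _))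
    linarith

theorem BddLip.const_mul {Ω : E3 → ℝ} {K : ℝ} (h : BddLip Ω K) {c : ℝ} (hc : 0 ≤ c) :
    BddLip (fun x => c * Ω x) (c * K) where
  bound x := by
    rw [abs_mul, abs_of_nonneg hc]
    exact mul_le_mul_of_nonneg_left (h.bound x) hc
  lip x y := by
    rw [← mul_sub, abs_mul, abs_of_nonneg hc, mul_assoc]
    exact mul_le_mul_of_nonneg_left (h.lip x y) hc

/-! ### Coulomb potentials of densities controlled by Hardy's inequality -/

/-- `ρ` is integrable and its integrals against `1` and against `|x - ·|⁻²`, for all `x`, are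
absolutely bounded by `K`. -/
structure HardyDensity (ρ : E3 → ℝ) (K : ℝ) : Prop where
  integrable : Integrable ρ
  integral_abs_le : ∫ y, |ρ y| ≤ K
  integrable_hardy : ∀ x, Integrable fun y => (‖x - y‖⁻¹) ^ 2 * |ρ y|
  integral_hardy_le : ∀ x, ∫ y, (‖x - y‖⁻¹) ^ 2 * |ρ y| ≤ K

namespace HardyDensity

variable {ρ σ : E3 → ℝ} {K : ℝ}

theorem of_abs_le (h : HardyDensity ρ K) (hm : AEStronglyMeasurable σ) {c : ℝ} (hc : 0 ≤ c)
    (hσ : ∀ᵐ x, |σ x| ≤ c * |ρ x|) : HardyDensity σ (c * K) where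
  integrable := (h.integrable.abs.const_mul c).mono' hm hσ
  integral_abs_le := by
    refine (integral_mono_ae ((h.integrable.abs.const_mul c).mono' hm hσ).abs
      (h.integrable.abs.const_mul c) hσ).trans ?_
    rw [integral_const_mul]
    exact mul_le_mul_of_nonneg_left h.integral_abs_le hc
  integrable_hardy x := by
    refine ((h.integrable_hardy x).const_mul c).mono' ?_ ?_
    · refine AEStronglyMeasurable.mul ?_ hm.norm
      exact Measurable.aestronglyMeasurable (by fun_prop)
    · filter_upwards [hσ] with y hy
      rw [Real.norm_of_nonneg (by positivity), mul_left_comm]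
      gcongr
  integral_hardy_le x := by
    have hle : ∀ᵐ y, (‖x - y‖⁻¹) ^ 2 * |σ y| ≤ c * ((‖x - y‖⁻¹) ^ 2 * |ρ y|) := by
      filter_upwards [hσ] with y hy
      rw [mul_left_comm]
      gcongr
    refine (integral_mono_of_nonneg (ae_of_all _ fun y => by positivity)
      ((h.integrable_hardy x).const_mul c) hle).trans ?_
    rw [integral_const_mul]
    exact mul_le_mul_of_nonneg_left (h.integral_hardy_le x) hc

theorem add {K' : ℝ} (h : HardyDensity ρ K) (h' : HardyDensity σ K') :
    HardyDensity (fun x => ρ x + σ x) (K + K') where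
  integrable := h.integrable.add h'.integrable
  integral_abs_le := by
    refine (integral_mono (h.integrable.add h'.integrable).abs
      (h.integrable.abs.add h'.integrable.abs) fun x => abs_add_le _ _).trans ?_
    simp only [Pi.add_apply]
    rw [integral_add h.integrable.abs h'.integrable.abs]
    exact add_le_add h.integral_abs_le h'.integral_abs_le
  integrable_hardy x := by
    refine ((h.integrable_hardy x).add (h'.integrable_hardy x)).mono' ?_ (ae_of_all _ fun y => ?_)
    · refine AEStronglyMeasurable.mul ?_ (h.integrable.add h'.integrable).abs.aestronglyMeasurable
      exact Measurable.aestronglyMeasurable (by fun_prop)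
    · rw [Real.norm_of_nonneg (by positivity), Pi.add_apply, ← mul_add]
      gcongr
      exact abs_add_le _ _
  integral_hardy_le x := by
    refine (integral_mono_of_nonneg (ae_of_all _ fun y => by positivity)
      ((h.integrable_hardy x).add (h'.integrable_hardy x)) (ae_of_all _ fun y => ?_)).trans ?_
    · simp only [Pi.add_apply]
      rw [← mul_add]
      gcongr
      exact abs_add_le _ _
    · simp only [Pi.add_apply]
      rw [integral_add (h.integrable_hardy x) (h'.integrable_hardy x)]
      exact add_le_add (h.integral_hardy_le x) (h'.integral_hardy_le x)

theorem bddLip_mul {Ω : E3 → ℝ} {L : ℝ} (h : HardyDensity ρ K) (hΩ : BddLip Ω L) :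
    HardyDensity (fun x => Ω x * ρ x) (L * K) :=
  h.of_abs_le (hΩ.continuous.aestronglyMeasurable.mul h.integrable.aestronglyMeasurable) hΩ.nonneg
    (ae_of_all _ fun x => by
      rw [Pi.mul_apply, abs_mul]; gcongr; exact hΩ.bound x)

theorem abs (h : HardyDensity ρ K) : HardyDensity (fun x => |ρ x|) K := by
  have := h.of_abs_le h.integrable.abs.aestronglyMeasurable zero_le_one
    (ae_of_all _ fun x => by rw [abs_abs, one_mul])
  rwa [one_mul] at this

end HardyDensity

/-- The Coulomb potential generated by the density `ρ`. -/
def pot (ρ : E3 → ℝ) (x : E3) : ℝ := ∫ y, ‖x - y‖⁻¹ * ρ y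

theorem measurable_kernel (x : E3) : Measurable fun y : E3 => ‖x - y‖⁻¹ := by fun_prop

theorem mul_le_half_sq (a b c : ℝ) (hc : 0 ≤ c) :
    a * b * c ≤ 1 / 2 * (a ^ 2 * c) + 1 / 2 * (b ^ 2 * c) := by
  nlinarith [mul_nonneg (sq_nonneg (a - b)) hc]

namespace HardyDensity

variable {ρ σ : E3 → ℝ} {K : ℝ}

theorem integrable_kernel_mul_kernel (h : HardyDensity ρ K) (x x' : E3) :
    Integrable (fun y => ‖x - y‖⁻¹ * ‖x' - y‖⁻¹ * |ρ y|) ∧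
      ∫ y, ‖x - y‖⁻¹ * ‖x' - y‖⁻¹ * |ρ y| ≤ K := by
  have hi := ((h.integrable_hardy x).const_mul (1 / 2)).add
    ((h.integrable_hardy x').const_mul (1 / 2))
  have hle : ∀ y, ‖x - y‖⁻¹ * ‖x' - y‖⁻¹ * |ρ y| ≤
      1 / 2 * ((‖x - y‖⁻¹) ^ 2 * |ρ y|) + 1 / 2 * ((‖x' - y‖⁻¹) ^ 2 * |ρ y|) := fun y =>
    mul_le_half_sq _ _ _ (abs_nonneg _)
  have hint : Integrable (fun y => ‖x - y‖⁻¹ * ‖x' - y‖⁻¹ * |ρ y|) := by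
    refine hi.mono' ?_ (ae_of_all _ fun y => ?_)
    · exact (((measurable_kernel x).mul (measurable_kernel x')).aestronglyMeasurable).mul
        h.integrable.abs.aestronglyMeasurable
    · rw [Real.norm_of_nonneg (by positivity)]
      exact hle y
  refine ⟨hint, (integral_mono hint hi hle).trans ?_⟩
  simp only [Pi.add_apply]
  rw [integral_add ((h.integrable_hardy x).const_mul (1 / 2))
    ((h.integrable_hardy x').const_mul (1 / 2)), integral_const_mul, integral_const_mul]
  linarith [h.integral_hardy_le x, h.integral_hardy_le x']

theorem integrable_kernel_abs (h : HardyDensity ρ K) (x : E3) :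
    Integrable (fun y => ‖x - y‖⁻¹ * |ρ y|) ∧ ∫ y, ‖x - y‖⁻¹ * |ρ y| ≤ K := by
  have hi := ((h.integrable_hardy x).const_mul (1 / 2)).add (h.integrable.abs.const_mul (1 / 2))
  have hle : ∀ y, ‖x - y‖⁻¹ * |ρ y| ≤
      1 / 2 * ((‖x - y‖⁻¹) ^ 2 * |ρ y|) + 1 / 2 * |ρ y| := fun y => by
    simpa using mul_le_half_sq ‖x - y‖⁻¹ 1 |ρ y| (abs_nonneg _)
  have hint : Integrable (fun y => ‖x - y‖⁻¹ * |ρ y|) := by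
    refine hi.mono' ?_ (ae_of_all _ fun y => ?_)
    · exact (measurable_kernel x).aestronglyMeasurable.mul h.integrable.abs.aestronglyMeasurable
    · rw [Real.norm_of_nonneg (by positivity)]
      exact hle y
  refine ⟨hint, (integral_mono hint hi hle).trans ?_⟩
  simp only [Pi.add_apply]
  rw [integral_add ((h.integrable_hardy x).const_mul (1 / 2)) (h.integrable.abs.const_mul (1 / 2)),
    integral_const_mul, integral_const_mul]
  linarith [h.integral_hardy_le x, h.integral_abs_le]

theorem integrable_kernel (h : HardyDensity ρ K) (x : E3) :
    Integrable (fun y => ‖x - y‖⁻¹ * ρ y) := by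
  refine (h.integrable_kernel_abs x).1.mono' ?_ (ae_of_all _ fun y => ?_)
  · exact (measurable_kernel x).aestronglyMeasurable.mul h.integrable.aestronglyMeasurable
  · rw [norm_mul, Real.norm_of_nonneg (by positivity), Real.norm_eq_abs]

/-- Boundedness uses `r⁻¹ ≤ (r⁻² + 1)/2`. For the Lipschitz bound, `| |x-y|⁻¹ - |x'-y|⁻¹ | ≤ |x-x'|
|x-y|⁻¹ |x'-y|⁻¹`, and the product of kernels is handled by the arithmetic-geometric mean
inequality. -/
theorem bddLip_pot (h : HardyDensity ρ K) : BddLip (pot ρ) K where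
  bound x := by
    rw [pot, ← Real.norm_eq_abs]
    refine (norm_integral_le_integral_norm _).trans (le_of_eq_of_le ?_ (h.integrable_kernel_abs x).2)
    refine integral_congr_ae (ae_of_all _ fun y => ?_)
    simp
  lip x x' := by
    have hne : ∀ z : E3, ∀ᵐ y : E3, y ≠ z := fun z => by
      simp [ae_iff, Set.ofPred_eq_eq_singleton]
    have h2 := h.integrable_kernel_mul_kernel x x'
    rw [pot, pot, ← integral_sub (h.integrable_kernel x) (h.integrable_kernel x'), ← Real.norm_eq_abs]
    refine (norm_integral_le_integral_norm _).trans ?_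
    calc ∫ y, ‖‖x - y‖⁻¹ * ρ y - ‖x' - y‖⁻¹ * ρ y‖
        ≤ ∫ y, ‖x - x'‖ * (‖x - y‖⁻¹ * ‖x' - y‖⁻¹ * |ρ y|) := by
          refine integral_mono_ae ((h.integrable_kernel x).sub (h.integrable_kernel x')).norm
            (h2.1.const_mul _) ?_
          filter_upwards [hne x, hne x'] with y h3 h4
          have h5 : 0 < ‖x - y‖ := norm_pos_iff.2 (sub_ne_zero.2 h3.symm)
          have h6 : 0 < ‖x' - y‖ := norm_pos_iff.2 (sub_ne_zero.2 h4.symm)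
          have h7 : |‖x' - y‖ - ‖x - y‖| ≤ ‖x - x'‖ := by
            refine (abs_norm_sub_norm_le _ _).trans ?_
            rw [sub_sub_sub_cancel_right, norm_sub_rev]
          rw [← sub_mul, norm_mul, inv_sub_inv h5.ne' h6.ne', norm_div, Real.norm_eq_abs,
            Real.norm_eq_abs, Real.norm_eq_abs, abs_of_pos (mul_pos h5 h6), div_eq_mul_inv,
            mul_inv]
          have := mul_le_mul_of_nonneg_right h7
            (by positivity : 0 ≤ ‖x - y‖⁻¹ * ‖x' - y‖⁻¹ * |ρ y|)
          linarith
      _ ≤ K * ‖x - x'‖ := by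
          rw [integral_const_mul, mul_comm]
          gcongr
          exact h2.2

theorem integrable_prod_kernel (h : HardyDensity ρ K) (hσ : Integrable σ) :
    Integrable (fun p : E3 × E3 => ‖p.1 - p.2‖⁻¹ * ρ p.2 * σ p.1) (volume.prod volume) := by
  have hm : AEStronglyMeasurable (fun p : E3 × E3 => ‖p.1 - p.2‖⁻¹ * ρ p.2 * σ p.1)
      (volume.prod volume) := by
    refine AEStronglyMeasurable.mul (AEStronglyMeasurable.mul ?_ ?_) ?_
    · exact Measurable.aestronglyMeasurable (by fun_prop)
    · exact h.integrable.aestronglyMeasurable.comp_snd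
    · exact hσ.aestronglyMeasurable.comp_fst
  refine (integrable_prod_iff hm).2 ⟨ae_of_all _ fun x => ?_, ?_⟩
  · exact (h.integrable_kernel x).mul_const (σ x)
  · have : (fun x => ∫ y, ‖‖x - y‖⁻¹ * ρ y * σ x‖) = fun x => pot (fun y => |ρ y|) x * |σ x| := by
      funext x
      rw [pot, ← integral_mul_const]
      refine integral_congr_ae (ae_of_all _ fun y => ?_)
      simp
    simp only [this]
    exact hσ.abs.bdd_mul h.abs.bddLip_pot.continuous.aestronglyMeasurable
      (ae_of_all _ h.abs.bddLip_pot.bound)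

/-- Fubini and symmetry of the kernel. -/
theorem integral_pot_mul (h : HardyDensity ρ K) (hσ : Integrable σ) :
    ∫ x, pot ρ x * σ x = ∫ x, ρ x * pot σ x := by
  have h1 := integral_integral_swap (f := fun x y => ‖x - y‖⁻¹ * ρ y * σ x)
    (h.integrable_prod_kernel hσ)
  have h2 : ∀ x, ∫ y, ‖x - y‖⁻¹ * ρ y * σ x = pot ρ x * σ x := fun x => by
    rw [integral_mul_const, pot]
  have h3 : ∀ y, ∫ x, ‖x - y‖⁻¹ * ρ y * σ x = ρ y * pot σ y := fun y => by
    rw [pot, ← integral_const_mul]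
    refine integral_congr_ae (ae_of_all _ fun x => ?_)
    simp only
    rw [norm_sub_rev]
    ring
  simpa only [h2, h3] using h1

theorem pot_sub {K' : ℝ} (h : HardyDensity ρ K) (h' : HardyDensity σ K') (x : E3) :
    pot (fun y => ρ y - σ y) x = pot ρ x - pot σ x := by
  rw [pot, pot, pot, ← integral_sub (h.integrable_kernel x) (h'.integrable_kernel x)]
  simp only [mul_sub]

end HardyDensity

/-! ### Mean field and interaction energy in terms of potentials -/

theorem integral_add_add {f g h : E3 → ℝ} (hf : Integrable f) (hg : Integrable g)
    (hh : Integrable h) :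
    ∫ x, (f x + g x + h x) = (∫ x, f x) + (∫ x, g x) + ∫ x, h x := by
  rw [← integral_add hf hg]
  exact integral_add (hf.add hg) hh

/-- The term centred at `x` factorizes into a square; the terms centred at `y` and at `z` agree by
Fubini, which explains the factor `2`. -/
theorem meanField_eq {lam K : ℝ} {f : E3 → ℂ} (h : HardyDensity (fun x => ‖f x‖ ^ 2) K) (x : E3) :
    meanField lam f x = lam / 2 * (pot (fun y => ‖f y‖ ^ 2) x * pot (fun y => ‖f y‖ ^ 2) x +
      2 * pot (fun y => pot (fun z => ‖f z‖ ^ 2) y * ‖f y‖ ^ 2) x) := by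
  set ρ : E3 → ℝ := fun x => ‖f x‖ ^ 2
  have hρ : ∀ y, ‖f y‖ ^ 2 = ρ y := fun _ => rfl
  have hρ0 : ∀ y, |ρ y| = ρ y := fun y => abs_of_nonneg (by positivity)
  have hpρ := h.bddLip_mul h.bddLip_pot
  have hτ : Integrable fun z => ‖x - z‖⁻¹ * ρ z := h.integrable_kernel x
  have h3 := fun y => (h.integrable_kernel_mul_kernel x y).1
  simp only [hρ0] at h3
  have hinner : ∀ y, ∫ z, V lam x y z * ρ y * ρ z = lam * ((‖x - y‖⁻¹ * ρ y) * pot ρ x +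
      ‖x - y‖⁻¹ * (pot ρ y * ρ y) + ρ y * pot (fun z => ‖x - z‖⁻¹ * ρ z) y) := by
    intro y
    have e1 : ∀ z, V lam x y z * ρ y * ρ z = lam * (‖x - y‖⁻¹ * ρ y * (‖x - z‖⁻¹ * ρ z) +
        ‖x - y‖⁻¹ * ρ y * (‖y - z‖⁻¹ * ρ z) + ρ y * (‖x - z‖⁻¹ * ‖y - z‖⁻¹ * ρ z)) := by
      intro z
      rw [V, norm_sub_rev y x, norm_sub_rev z x, norm_sub_rev z y]
      ring
    simp only [e1]
    rw [integral_const_mul, integral_add_add ((h.integrable_kernel x).const_mul _)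
      ((h.integrable_kernel y).const_mul _) ((h3 y).const_mul _),
      integral_const_mul, integral_const_mul, integral_const_mul]
    have e2 : ∫ z, ‖x - z‖⁻¹ * ‖y - z‖⁻¹ * ρ z = pot (fun z => ‖x - z‖⁻¹ * ρ z) y := by
      rw [pot]
      refine integral_congr_ae (ae_of_all _ fun z => ?_)
      simp only
      ring
    rw [e2]
    simp only [pot]
    ring
  have i3 : Integrable fun y => ρ y * pot (fun z => ‖x - z‖⁻¹ * ρ z) y := by
    have := (h.integrable_prod_kernel hτ).integral_prod_right
    refine this.congr (ae_of_all _ fun y => ?_)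
    simp only
    rw [pot, ← integral_const_mul]
    refine integral_congr_ae (ae_of_all _ fun z => ?_)
    simp only
    rw [norm_sub_rev z y]
    ring
  have i1 := (h.integrable_kernel x).mul_const (pot ρ x)
  have i2 := hpρ.integrable_kernel x
  rw [meanField]
  simp only [hρ, hinner]
  rw [integral_const_mul, integral_add_add i1 i2 i3, integral_mul_const,
    ← h.integral_pot_mul hτ]
  have e3 : ∫ z, pot ρ z * (‖x - z‖⁻¹ * ρ z) = pot (fun y => pot ρ y * ρ y) x := by
    rw [pot]
    refine integral_congr_ae (ae_of_all _ fun z => ?_)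
    simp only
    ring
  rw [e3]
  simp only [pot]
  ring

/-- The density `|u|²`. -/
def dens (u : H1) (x : E3) : ℝ := ‖toL2 u x‖ ^ 2

/-- The mean-field potential in terms of the density. -/
def meanPot (lam : ℝ) (ρ : E3 → ℝ) (x : E3) : ℝ :=
  lam / 2 * (pot ρ x * pot ρ x + 2 * pot (fun y => pot ρ y * ρ y) x)

/-- The interaction energy of the density `ρ`. -/
def interaction (lam : ℝ) (ρ : E3 → ℝ) : ℝ := lam / 2 * ∫ x, pot ρ x * pot ρ x * ρ x

/-- The discrete derivative of the interaction energy. -/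
def meanPotDiff (lam : ℝ) (ρ σ : E3 → ℝ) (x : E3) : ℝ :=
  lam / 2 * (pot ρ x * pot ρ x + pot (fun y => (pot ρ y + pot σ y) * σ y) x)

theorem integral_mul_le_sqrt {F G : E3 → ℝ} (hF : AEStronglyMeasurable F)
    (hG : AEStronglyMeasurable G) (hF2 : Integrable fun x => F x ^ 2)
    (hG2 : Integrable fun x => G x ^ 2) (hF0 : ∀ x, 0 ≤ F x) (hG0 : ∀ x, 0 ≤ G x) {A B : ℝ}
    (hA : 0 ≤ A) (hB : 0 ≤ B) (hFA : ∫ x, F x ^ 2 ≤ A ^ 2) (hGB : ∫ x, G x ^ 2 ≤ B ^ 2) :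
    Integrable (fun x => F x * G x) ∧ ∫ x, F x * G x ≤ A * B := by
  have mF : MemLp F 2 := (memLp_two_iff_integrable_sq hF).2 hF2
  have mG : MemLp G 2 := (memLp_two_iff_integrable_sq hG).2 hG2
  refine ⟨mF.integrable_mul mG, ?_⟩
  have h := integral_mul_le_Lp_mul_Lq_of_nonneg (μ := (volume : Measure E3)) (f := F) (g := G)
    Real.HolderConjugate.two_two (ae_of_all _ hF0) (ae_of_all _ hG0) (by simpa using mF)
    (by simpa using mG)
  refine h.trans ?_
  simp only [Real.rpow_two, ← Real.sqrt_eq_rpow]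
  refine mul_le_mul ?_ ?_ (Real.sqrt_nonneg _) hA
  · exact (Real.sqrt_le_left hA).2 hFA
  · exact (Real.sqrt_le_left hB).2 hGB

/-- Cauchy–Schwarz: Hardy gives `(2 ‖u‖)(2 ‖v‖)` for the weighted integral, and the plain integral
is at most `‖u‖ ‖v‖`. -/
theorem hardyDensity_mul (u v : H1) :
    HardyDensity (fun x => ‖toL2 u x‖ * ‖toL2 v x‖) (4 * (‖u‖ * ‖v‖)) := by
  have hm := fun u : H1 => (Lp.aestronglyMeasurable (toL2 u)).norm
  have h0 : 0 ≤ ‖u‖ * ‖v‖ := by positivity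
  have hsq : ∀ (u : H1) (x y : E3), (‖x - y‖⁻¹ * ‖toL2 u y‖) ^ 2 =
      (‖y - x‖⁻¹) ^ 2 * ‖toL2 u y‖ ^ 2 := fun u x y => by rw [mul_pow, norm_sub_rev]
  have hH : ∀ x, Integrable (fun y => (‖x - y‖⁻¹ * ‖toL2 u y‖) * (‖x - y‖⁻¹ * ‖toL2 v y‖)) ∧
      ∫ y, (‖x - y‖⁻¹ * ‖toL2 u y‖) * (‖x - y‖⁻¹ * ‖toL2 v y‖) ≤ (2 * ‖u‖) * (2 * ‖v‖) := by
    intro x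
    have hk := (measurable_kernel x).aestronglyMeasurable (μ := volume)
    refine integral_mul_le_sqrt (F := fun y => ‖x - y‖⁻¹ * ‖toL2 u y‖)
      (G := fun y => ‖x - y‖⁻¹ * ‖toL2 v y‖) (hk.mul (hm u)) (hk.mul (hm v)) ?_ ?_ (fun y => by positivity)
      (fun y => by positivity) (by positivity) (by positivity) ?_ ?_
    · simp only [hsq]; exact (hardy x u).1
    · simp only [hsq]; exact (hardy x v).1
    · simp only [hsq]; refine (hardy x u).2.trans_eq (by ring)
    · simp only [hsq]; refine (hardy x v).2.trans_eq (by ring)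
  have habs : ∀ x y : E3, (‖x - y‖⁻¹) ^ 2 * |‖toL2 u y‖ * ‖toL2 v y‖| =
      (‖x - y‖⁻¹ * ‖toL2 u y‖) * (‖x - y‖⁻¹ * ‖toL2 v y‖) := fun x y => by
    rw [abs_of_nonneg (by positivity)]; ring
  have hi : ∀ u : H1, Integrable fun x => ‖toL2 u x‖ ^ 2 := fun u =>
    (Lp.memLp (toL2 u)).integrable_norm_pow (by norm_num)
  have hI := integral_mul_le_sqrt (hm u) (hm v) (hi u) (hi v) (fun _ => norm_nonneg _)
    (fun _ => norm_nonneg _) (norm_nonneg u) (norm_nonneg v)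
    (by rw [← norm_sq_L2]; gcongr; exact norm_toL2_le u)
    (by rw [← norm_sq_L2]; gcongr; exact norm_toL2_le v)
  refine ⟨hI.1, ?_, fun x => ?_, fun x => ?_⟩
  · have : ∀ x, |‖toL2 u x‖ * ‖toL2 v x‖| = ‖toL2 u x‖ * ‖toL2 v x‖ := fun x =>
      abs_of_nonneg (by positivity)
    simp only [this]
    linarith [hI.2]
  · simp only [habs]; exact (hH x).1
  · simp only [habs]; linarith [(hH x).2]

theorem hardyDensity_dens (u : H1) : HardyDensity (dens u) (4 * ‖u‖ ^ 2) := by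
  have := hardyDensity_mul u u
  simp only [← sq] at this
  exact this

theorem coeFn_toL2_add (u v : H1) : toL2 (u + v) =ᵐ[volume] fun x => toL2 u x + toL2 v x :=
  Lp.coeFn_add (toL2 u) (toL2 v)

theorem coeFn_toL2_sub (u v : H1) : toL2 (u - v) =ᵐ[volume] fun x => toL2 u x - toL2 v x :=
  Lp.coeFn_sub (toL2 u) (toL2 v)

/-- Polarization, which makes differences of densities small in `u - v` and the discrete gradient
exact. -/
theorem dens_sub_dens (u v : H1) : (fun x => dens u x - dens v x) =ᵐ[volume]
    fun x => (starRingEnd ℂ (toL2 (u + v) x) * toL2 (u - v) x).re := by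
  filter_upwards [coeFn_toL2_add u v, coeFn_toL2_sub u v] with x h1 h2
  rw [h1, h2, dens, dens, ← Complex.normSq_eq_norm_sq, ← Complex.normSq_eq_norm_sq,
    Complex.normSq_apply, Complex.normSq_apply]
  simp
  ring

theorem hardyDensity_dens_sub (u v : H1) :
    HardyDensity (fun x => dens u x - dens v x) (4 * (‖u + v‖ * ‖u - v‖)) := by
  have h := hardyDensity_mul (u + v) (u - v)
  rw [← one_mul (4 * _)]
  refine h.of_abs_le ((hardyDensity_dens u).integrable.sub
    (hardyDensity_dens v).integrable).aestronglyMeasurable zero_le_one ?_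
  filter_upwards [dens_sub_dens u v] with x hx
  change |dens u x - dens v x| ≤ _
  rw [hx, one_mul, abs_of_nonneg (a := _ * _) (by positivity)]
  refine (Complex.abs_re_le_norm _).trans ?_
  simp

theorem meanField_toL2 (lam : ℝ) (u : H1) : meanField lam (toL2 u) = meanPot lam (dens u) :=
  funext fun x => meanField_eq (hardyDensity_dens u) x

theorem interaction_nonneg {lam : ℝ} (hlam : 0 ≤ lam) (u : H1) : 0 ≤ interaction lam (dens u) :=
  mul_nonneg (by positivity) (integral_nonneg fun x =>
    mul_nonneg (mul_self_nonneg _) (sq_nonneg _))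

section

variable {ρ σ : E3 → ℝ} {K L D lam : ℝ}

theorem integrable_pot_mul_pot_mul (h : HardyDensity ρ K) (h' : HardyDensity σ L) :
    Integrable fun x => pot ρ x * pot ρ x * σ x :=
  (h'.bddLip_mul (h.bddLip_pot.mul h.bddLip_pot)).integrable

theorem interaction_le (hlam : 0 ≤ lam) (h : HardyDensity ρ K) :
    interaction lam ρ ≤ lam * K ^ 3 := by
  have h1 := h.bddLip_mul (h.bddLip_pot.mul h.bddLip_pot)
  have h2 : ∫ x, pot ρ x * pot ρ x * ρ x ≤ 2 * (K * K) * K :=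
    (integral_mono h1.integrable h1.integrable.abs fun x => le_abs_self _).trans h1.integral_abs_le
  rw [interaction]
  calc lam / 2 * _ ≤ lam / 2 * (2 * (K * K) * K) := by gcongr
    _ = lam * K ^ 3 := by ring

/-- Split the difference as `(pot ρ)² (ρ - σ) + ((pot ρ)² - (pot σ)²) σ`; symmetry of the kernel
moves `pot` off `ρ - σ` in the second term. -/
theorem interaction_sub (h : HardyDensity ρ K) (h' : HardyDensity σ L) :
    interaction lam ρ - interaction lam σ = ∫ x, meanPotDiff lam ρ σ x * (ρ x - σ x) := by
  have hδ : Integrable fun x => ρ x - σ x := h.integrable.sub h'.integrable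
  have hs := h'.bddLip_mul (h.bddLip_pot.add h'.bddLip_pot)
  have e1 := hs.integral_pot_mul hδ
  simp only [h.pot_sub h'] at e1
  have i1 := integrable_pot_mul_pot_mul h h
  have i2 := integrable_pot_mul_pot_mul h' h'
  have i3 := integrable_pot_mul_pot_mul h h'
  have e2 : ∀ x, (pot ρ x + pot σ x) * σ x * (pot ρ x - pot σ x) =
      pot ρ x * pot ρ x * σ x - pot σ x * pot σ x * σ x := fun x => by ring
  simp only [e2] at e1
  rw [integral_sub i3 i2] at e1
  have i4 : Integrable fun x => pot (fun y => (pot ρ y + pot σ y) * σ y) x * (ρ x - σ x) :=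
    hδ.bdd_mul hs.bddLip_pot.continuous.aestronglyMeasurable (ae_of_all _ hs.bddLip_pot.bound)
  have e3 : ∀ x, meanPotDiff lam ρ σ x * (ρ x - σ x) = lam / 2 *
      ((pot ρ x * pot ρ x * ρ x - pot ρ x * pot ρ x * σ x) +
        pot (fun y => (pot ρ y + pot σ y) * σ y) x * (ρ x - σ x)) := fun x => by
    rw [meanPotDiff]; ring
  have i13 : Integrable fun x => pot ρ x * pot ρ x * ρ x - pot ρ x * pot ρ x * σ x := i1.sub i3
  simp only [e3]
  rw [integral_const_mul, integral_add i13 i4, integral_sub i1 i3, e1, interaction,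
    interaction]
  ring

theorem bddLip_meanPot (hlam : 0 ≤ lam) (h : HardyDensity ρ K) :
    BddLip (meanPot lam ρ) (lam / 2 * (2 * (K * K) + 2 * (K * K))) :=
  ((h.bddLip_pot.mul h.bddLip_pot).add
    ((h.bddLip_mul h.bddLip_pot).bddLip_pot.const_mul zero_le_two)).const_mul (by positivity)

theorem bddLip_meanPotDiff (hlam : 0 ≤ lam) (h : HardyDensity ρ K) (h' : HardyDensity σ L) :
    BddLip (meanPotDiff lam ρ σ) (lam / 2 * (2 * (K * K) + (K + L) * L)) :=
  ((h.bddLip_pot.mul h.bddLip_pot).add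
    (h'.bddLip_mul (h.bddLip_pot.add h'.bddLip_pot)).bddLip_pot).const_mul (by positivity)

theorem bddLip_meanPotDiff_sub (hlam : 0 ≤ lam) (h : HardyDensity ρ K) (h' : HardyDensity σ L)
    (hδ : HardyDensity (fun x => ρ x - σ x) D) :
    BddLip (fun x => meanPotDiff lam ρ σ x - meanPot lam σ x)
      (lam / 2 * (2 * (D * (K + L)) + D * L)) := by
  have h1 := ((hδ.bddLip_pot.mul (h.bddLip_pot.add h'.bddLip_pot)).add
    (h'.bddLip_mul hδ.bddLip_pot).bddLip_pot).const_mul (c := lam / 2) (by positivity)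
  convert h1 using 2 with x
  have e1 : (fun y => pot (fun x => ρ x - σ x) y * σ y) = fun y =>
      (pot ρ y + pot σ y) * σ y - (2 : ℝ) * (pot σ y * σ y) := by
    funext y
    rw [h.pot_sub h']
    ring
  have hs := h'.bddLip_mul (h.bddLip_pot.add h'.bddLip_pot)
  have ht := (h'.bddLip_mul h'.bddLip_pot).add (h'.bddLip_mul h'.bddLip_pot)
  simp only [← two_mul] at ht
  rw [e1, hs.pot_sub ht, h.pot_sub h', meanPotDiff, meanPot]
  have e2 : pot (fun y => 2 * (pot σ y * σ y)) x = 2 * pot (fun y => pot σ y * σ y) x := by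
    rw [pot, pot, ← integral_const_mul]
    refine integral_congr_ae (ae_of_all _ fun y => ?_)
    simp only
    ring
  rw [e2]
  ring

theorem bddLip_meanPot_sub (hlam : 0 ≤ lam) (h : HardyDensity ρ K) (h' : HardyDensity σ L)
    (hδ : HardyDensity (fun x => ρ x - σ x) D) :
    BddLip (fun x => meanPot lam ρ x - meanPot lam σ x)
      (lam / 2 * (2 * (D * (K + L)) + 2 * (D * K + L * D))) := by
  have h1 := ((hδ.bddLip_pot.mul (h.bddLip_pot.add h'.bddLip_pot)).add
    (((h.bddLip_mul hδ.bddLip_pot).add (hδ.bddLip_mul h'.bddLip_pot)).bddLip_pot.const_mul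
      zero_le_two)).const_mul (c := lam / 2) (by positivity)
  convert h1 using 2 with x
  have e1 : (fun y => pot (fun x => ρ x - σ x) y * ρ y + pot σ y * (ρ y - σ y)) = fun y =>
      pot ρ y * ρ y - pot σ y * σ y := by
    funext y
    rw [h.pot_sub h']
    ring
  rw [e1, (h.bddLip_mul h.bddLip_pot).pot_sub (h'.bddLip_mul h'.bddLip_pot), h.pot_sub h',
    meanPot, meanPot]
  ring

end

/-! ### An abstract conservation law in Hilbert space -/

section Hilbert

variable {X : Type*} [NormedAddCommGroup X] [InnerProductSpace ℂ X]

theorem norm_le_of_dense_inner_le {ι : Type*} {v : ι → X} (hv : DenseRange v) {y : X} {C : ℝ}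
    (hC : 0 ≤ C) (h : ∀ a, ‖inner ℂ (v a) y‖ ≤ C * ‖v a‖) : ‖y‖ ≤ C := by
  have h1 : ‖inner ℂ y y‖ ≤ C * ‖y‖ :=
    hv.induction_on (p := fun x => ‖inner ℂ x y‖ ≤ C * ‖x‖) y
      (isClosed_le (by fun_prop) (by fun_prop)) h
  by_cases hy : y = 0
  · rwa [hy, norm_zero]
  · rw [inner_self_eq_norm_sq_to_K] at h1
    have h2 : 0 < ‖y‖ := norm_pos_iff.2 hy
    have h3 : ‖y‖ * ‖y‖ ≤ C * ‖y‖ := by simpa [sq] using h1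
    exact le_of_mul_le_mul_right h3 h2

/-- A weak derivative with norm-continuous values is a norm derivative. The mean value inequality
bounds the tested remainder uniformly relative to `‖v a‖`, and density turns this into a norm bound.
-/
theorem hasDerivWithinAt_of_dense_inner {ι : Type*} {v : ι → X} (hv : DenseRange v) {J : Set ℝ}
    (hJ : Convex ℝ J) {f k : ℝ → X} (hk : ContinuousOn k J)
    (h : ∀ a, ∀ t ∈ J, HasDerivWithinAt (fun s => inner ℂ (v a) (f s)) (inner ℂ (v a) (k t)) J t)
    {t : ℝ} (ht : t ∈ J) : HasDerivWithinAt f (k t) J t := by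
  rw [hasDerivWithinAt_iff_isLittleO, Asymptotics.isLittleO_iff]
  intro c hc
  obtain ⟨δ, hδ, hδc⟩ := Metric.continuousOn_iff.1 hk t ht c hc
  filter_upwards [inter_mem_nhdsWithin J (Metric.ball_mem_nhds t hδ)] with s hs
  refine norm_le_of_dense_inner_le hv (by positivity) fun a => ?_
  have hderiv : ∀ r ∈ J ∩ Metric.ball t δ, HasDerivWithinAt
      (fun r : ℝ => inner ℂ (v a) (f r) - r * inner ℂ (v a) (k t))
      (inner ℂ (v a) (k r) - inner ℂ (v a) (k t)) (J ∩ Metric.ball t δ) r := by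
    intro r hr
    have h1 := (h a r hr.1).mono (Set.inter_subset_left (t := Metric.ball t δ))
    have h2 : HasDerivWithinAt (fun r : ℝ => (r : ℂ) * inner ℂ (v a) (k t))
        (inner ℂ (v a) (k t)) (J ∩ Metric.ball t δ) r := by
      simpa using ((Complex.ofRealCLM.hasDerivAt (x := r)).mul_const
        (inner ℂ (v a) (k t))).hasDerivWithinAt
    exact h1.sub h2
  have hb : ∀ r ∈ J ∩ Metric.ball t δ,
      ‖inner ℂ (v a) (k r) - inner ℂ (v a) (k t)‖ ≤ c * ‖v a‖ := by
    intro r hr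
    rw [← inner_sub_right, mul_comm]
    refine (norm_inner_le_norm _ _).trans ?_
    gcongr
    rw [← dist_eq_norm]
    exact (hδc r hr.1 hr.2).le
  have := Convex.norm_image_sub_le_of_norm_hasDerivWithin_le hderiv hb
    (hJ.inter (convex_ball t δ)) ⟨ht, Metric.mem_ball_self hδ⟩ hs
  refine le_of_eq_of_le ?_ (this.trans_eq (by ring))
  congr 1
  rw [inner_sub_right, inner_sub_right, ← Complex.coe_smul, inner_smul_right]
  push_cast
  ring

variable [CompleteSpace X]

/-- The resolvent `(S + ε)⁻¹` of a nonnegative symmetric operator. -/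
theorem exists_resolvent (S : X →L[ℂ] X) (hpos : ∀ x, 0 ≤ (inner ℂ (S x) x).re) {ε : ℝ}
    (hε : 0 < ε) : ∃ Q : X →L[ℂ] X, ∀ x, S (Q x) + (ε : ℂ) • Q x = x ∧ Q (S x) = S (Q x) := by
  have hu : IsUnit (S + (ε : ℂ) • (1 : X →L[ℂ] X)) := by
    refine ContinuousLinearMap.isUnit_of_forall_le_norm_inner_map _ (c := ⟨ε, hε.le⟩) hε fun x => ?_
    refine le_trans ?_ (Complex.re_le_norm _)
    have : (inner ℂ ((ε : ℂ) • x) x).re = ‖x‖ ^ 2 * ε := by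
      rw [inner_smul_left, inner_self_eq_norm_sq_to_K]
      simp
      norm_cast
      ring
    change ‖x‖ ^ 2 * ε ≤ _
    simp only [_root_.add_apply, _root_.smul_apply, one_apply_eq_self, inner_add_left,
      Complex.add_re, this]
    linarith [hpos x]
  obtain ⟨u, hu⟩ := hu
  have hright : ∀ x, S ((↑u⁻¹ : X →L[ℂ] X) x) + (ε : ℂ) • (↑u⁻¹ : X →L[ℂ] X) x = x := by
    intro x
    have := congrArg (fun T : X →L[ℂ] X => T x) u.mul_inv
    simpa [hu] using this
  have hleft : ∀ x, (↑u⁻¹ : X →L[ℂ] X) (S x) + (ε : ℂ) • (↑u⁻¹ : X →L[ℂ] X) x = x := by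
    intro x
    have := congrArg (fun T : X →L[ℂ] X => T x) u.inv_mul
    simpa [hu] using this
  exact ⟨↑u⁻¹, fun x => ⟨hright x, add_right_cancel ((hleft x).trans (hright x).symm)⟩⟩

end Hilbert

section Hilbert

variable {X : Type*} [NormedAddCommGroup X] [InnerProductSpace ℂ X]

theorem norm_sq_add_smul_ge (S : X →L[ℂ] X) (hpos : ∀ x, 0 ≤ (inner ℂ (S x) x).re) {ε : ℝ}
    (hε : 0 < ε) (z : X) : ‖S z‖ ≤ ‖S z + (ε : ℂ) • z‖ ∧ ‖(ε : ℂ) • z‖ ≤ ‖S z + (ε : ℂ) • z‖ := by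
  have h1 := norm_add_sq (𝕜 := ℂ) (S z) ((ε : ℂ) • z)
  have h2 : 0 ≤ RCLike.re (inner ℂ (S z) ((ε : ℂ) • z)) := by
    rw [inner_smul_right]
    have := mul_nonneg hε.le (hpos z)
    simpa using this
  constructor <;> refine le_of_sq_le_sq ?_ (norm_nonneg _) <;>
    nlinarith [sq_nonneg ‖S z‖, sq_nonneg ‖(ε : ℂ) • z‖]

/-- With `Q n = (S + 1/(n+1))⁻¹`, the operators `S (Q n)` are contractions. On the range of `S`
their error is `S (Q n w) / (n+1)`, which tends to zero; density gives the rest. -/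
theorem exists_resolvent_seq [CompleteSpace X] (S : X →L[ℂ] X)
    (hpos : ∀ x, 0 ≤ (inner ℂ (S x) x).re) (hdense : DenseRange S) :
    ∃ Q : ℕ → X →L[ℂ] X, (∀ n x, Q n (S x) = S (Q n x)) ∧ (∀ n x, ‖S (Q n x)‖ ≤ ‖x‖) ∧
      ∀ x, Tendsto (fun n => S (Q n x)) atTop (𝓝 x) := by
  have hε : ∀ n : ℕ, (0 : ℝ) < 1 / ((n : ℝ) + 1) := fun n => by positivity
  choose Q hQ using fun n : ℕ => exists_resolvent S hpos (hε n)
  have hle : ∀ n x, ‖S (Q n x)‖ ≤ ‖x‖ := fun n x => by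
    have := (norm_sq_add_smul_ge S hpos (hε n) (Q n x)).1
    rwa [(hQ n x).1] at this
  refine ⟨Q, fun n x => (hQ n x).2, hle, fun x => ?_⟩
  rw [Metric.tendsto_atTop]
  intro η hη
  obtain ⟨w, hw⟩ := hdense.exists_dist_lt x (by positivity : 0 < η / 3)
  have hlim : Tendsto (fun n : ℕ => 1 / ((n : ℝ) + 1) * ‖w‖) atTop (𝓝 0) := by
    simpa using (tendsto_one_div_add_atTop_nhds_zero_nat (𝕜 := ℝ)).mul_const ‖w‖
  obtain ⟨N, hN⟩ := eventually_atTop.1 (hlim.eventually_lt_const (by positivity : 0 < η / 3))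
  refine ⟨N, fun n hn => ?_⟩
  have h1 : ‖S w - S (Q n (S w))‖ ≤ 1 / ((n : ℝ) + 1) * ‖w‖ := by
    have e1 : S w - S (Q n (S w)) = ((1 / ((n : ℝ) + 1) : ℝ) : ℂ) • S (Q n w) := by
      rw [sub_eq_iff_eq_add', ← (hQ n w).2, (hQ n (S w)).1]
    rw [e1, norm_smul, Complex.norm_real, Real.norm_of_nonneg (hε n).le]
    gcongr
    exact hle n w
  have e2 : S (Q n x) - x = S (Q n (x - S w)) - (x - S w) - (S w - S (Q n (S w))) := by
    simp only [map_sub]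
    abel
  rw [dist_eq_norm, e2]
  rw [dist_eq_norm] at hw
  have h2 := norm_sub_le (S (Q n (x - S w)) - (x - S w)) (S w - S (Q n (S w)))
  have h3 := norm_sub_le (S (Q n (x - S w))) (x - S w)
  have h4 := hle n (x - S w)
  have h5 := hN n hn
  linarith

theorem hasDerivWithinAt_norm_sq {f : ℝ → X} {f' : X} {J : Set ℝ} {t : ℝ}
    (h : HasDerivWithinAt f f' J t) :
    HasDerivWithinAt (fun s => ‖f s‖ ^ 2) (2 * (inner ℂ (f t) f').re) J t := by
  have h1 := Complex.reCLM.hasFDerivAt.comp_hasDerivWithinAt t (h.inner ℂ h)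
  have e1 : (fun s => ‖f s‖ ^ 2) = Complex.reCLM ∘ fun s => inner ℂ (f s) (f s) := by
    funext s
    exact (inner_self_eq_norm_sq (𝕜 := ℂ) (f s)).symm
  rw [e1]
  refine h1.congr_deriv ?_
  have h2 : (inner ℂ f' (f t)).re = (inner ℂ (f t) f').re := inner_re_symm (𝕜 := ℂ) _ _
  simp [h2]
  ring

/-- Symmetry makes `⟨Sz, z⟩` real, so only the pairing with `w` survives multiplication by `-i`. -/
theorem re_inner_resolvent (S : X →L[ℂ] X)
    (hsym : ∀ x y, inner ℂ (S x) y = inner ℂ x (S y)) (z w : X) :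
    (inner ℂ (S z) (-Complex.I • (z - S z + w))).re = (inner ℂ (S z) w).im := by
  have h1 : (inner ℂ (S z) z).im = 0 :=
    Complex.conj_eq_iff_im.1 (by rw [inner_conj_symm, hsym])
  have h2 : (inner ℂ (S z) (S z)).im = 0 := inner_self_im (𝕜 := ℂ) (S z)
  rw [inner_smul_right, inner_add_right, inner_sub_right]
  simp [h1, h2, -inner_self_eq_norm_sq_to_K]

/-- Replace `φ` by `S (Q n φ) = Q n (S φ)`, which is differentiable, integrate the derivative in
time, and let `n → ∞` by dominated convergence; the limiting integrand is zero. -/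
theorem norm_sq_add_eq_of_hasDerivWithinAt [CompleteSpace X] (S : X →L[ℂ] X)
    (hsym : ∀ x y, inner ℂ (S x) y = inner ℂ x (S y)) (hpos : ∀ x, 0 ≤ (inner ℂ (S x) x).re)
    (hdense : DenseRange S) {J : Set ℝ} (hJ : J.OrdConnected) (h0 : (0 : ℝ) ∈ J) {φ g : ℝ → X}
    (hφ : ContinuousOn φ J) (hg : ContinuousOn g J)
    (hS : ∀ t ∈ J, HasDerivWithinAt (fun s => S (φ s))
      (-Complex.I • (φ t - S (φ t) + S (g t))) J t)
    {F : ℝ → ℝ} (hF : ∀ t ∈ J, HasDerivWithinAt F (-(2 * (inner ℂ (φ t) (g t)).im)) J t)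
    {t : ℝ} (ht : t ∈ J) : ‖φ t‖ ^ 2 + F t = ‖φ 0‖ ^ 2 + F 0 := by
  obtain ⟨Q, hQS, hQle, hQlim⟩ := exists_resolvent_seq S hpos hdense
  have hsub : Set.uIcc 0 t ⊆ J := hJ.uIcc_subset h0 ht
  have hE : ∀ n, ∀ r ∈ J, HasDerivWithinAt (fun s => ‖S (Q n (φ s))‖ ^ 2 + F s)
      (2 * (inner ℂ (S (Q n (φ r))) (S (Q n (g r)))).im - 2 * (inner ℂ (φ r) (g r)).im) J r := by
    intro n r hr
    have h1 : HasDerivWithinAt (fun s => S (Q n (φ s)))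
        (Q n (-Complex.I • (φ r - S (φ r) + S (g r)))) J r := by
      simp only [← hQS]
      exact ((Q n).restrictScalars ℝ).hasFDerivAt.comp_hasDerivWithinAt r (hS r hr)
    have h2 := (hasDerivWithinAt_norm_sq h1).add (hF r hr)
    refine h2.congr_deriv ?_
    rw [map_smul, map_add, map_sub, hQS, hQS, re_inner_resolvent S hsym]
    ring
  have hcont : ∀ n, ContinuousOn (fun r => 2 * (inner ℂ (S (Q n (φ r))) (S (Q n (g r)))).im -
      2 * (inner ℂ (φ r) (g r)).im) (Set.uIcc 0 t) := by
    intro n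
    have c1 := hφ.mono hsub
    have c2 := hg.mono hsub
    have hT : Continuous fun x => S (Q n x) := S.continuous.comp (Q n).continuous
    have c3 := Complex.continuous_im.comp_continuousOn
      ((hT.comp_continuousOn c1).inner (𝕜 := ℂ) (hT.comp_continuousOn c2))
    have c4 := Complex.continuous_im.comp_continuousOn (c1.inner (𝕜 := ℂ) c2)
    exact (c3.const_mul 2).sub (c4.const_mul 2)
  have hFTC : ∀ n, ∫ r in (0 : ℝ)..t, (2 * (inner ℂ (S (Q n (φ r))) (S (Q n (g r)))).im -
      2 * (inner ℂ (φ r) (g r)).im) =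
      (‖S (Q n (φ t))‖ ^ 2 + F t) - (‖S (Q n (φ 0))‖ ^ 2 + F 0) := by
    intro n
    refine intervalIntegral.integral_eq_sub_of_hasDeriv_right
      (f := fun s => ‖S (Q n (φ s))‖ ^ 2 + F s) ?_ ?_ (hcont n).intervalIntegrable
    · exact fun r hr => ((hE n r (hsub hr)).continuousWithinAt).mono hsub
    -- Only interior times of the segment matter here, so the derivative within `J` is two-sided.
    · intro r hr
      have hnhds : J ∈ 𝓝 r := mem_of_superset (Icc_mem_nhds hr.1 hr.2) hsub
      exact ((hE n r (mem_of_mem_nhds hnhds)).hasDerivAt hnhds).hasDerivWithinAt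
  have hlim : Tendsto (fun n => ∫ r in (0 : ℝ)..t,
      (2 * (inner ℂ (S (Q n (φ r))) (S (Q n (g r)))).im - 2 * (inner ℂ (φ r) (g r)).im))
      atTop (𝓝 (∫ _ in (0 : ℝ)..t, (0 : ℝ))) := by
    refine intervalIntegral.tendsto_integral_filter_of_dominated_convergence
      (fun r => 4 * (‖φ r‖ * ‖g r‖)) (Eventually.of_forall fun n => ?_)
      (Eventually.of_forall fun n => ae_of_all _ fun r _ => ?_) ?_ (ae_of_all _ fun r _ => ?_)
    · exact ((hcont n).mono Set.uIoc_subset_uIcc).aestronglyMeasurable measurableSet_uIoc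
    · have b1 : |(inner ℂ (S (Q n (φ r))) (S (Q n (g r)))).im| ≤ ‖φ r‖ * ‖g r‖ :=
        (Complex.abs_im_le_norm _).trans ((norm_inner_le_norm _ _).trans
          (mul_le_mul (hQle n _) (hQle n _) (norm_nonneg _) (norm_nonneg _)))
      have b2 : |(inner ℂ (φ r) (g r)).im| ≤ ‖φ r‖ * ‖g r‖ :=
        (Complex.abs_im_le_norm _).trans (norm_inner_le_norm _ _)
      rw [Real.norm_eq_abs]
      rw [abs_le] at *
      constructor <;> linarith [b1.1, b1.2, b2.1, b2.2]
    · exact (((hφ.mono hsub).norm.mul (hg.mono hsub).norm).const_mul 4).intervalIntegrable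
    · have h1 := Complex.continuous_im.tendsto _ |>.comp
        ((hQlim (φ r)).inner (𝕜 := ℂ) (hQlim (g r)))
      have h2 := (h1.const_mul 2).sub_const (2 * (inner ℂ (φ r) (g r)).im)
      rwa [sub_self] at h2
  simp only [hFTC, intervalIntegral.integral_zero] at hlim
  have hlim2 : Tendsto (fun n => (‖S (Q n (φ t))‖ ^ 2 + F t) - (‖S (Q n (φ 0))‖ ^ 2 + F 0)) atTop
      (𝓝 ((‖φ t‖ ^ 2 + F t) - (‖φ 0‖ ^ 2 + F 0))) :=
    (((hQlim _).norm.pow 2).add_const _).sub (((hQlim _).norm.pow 2).add_const _)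
  exact sub_eq_zero.1 (tendsto_nhds_unique hlim2 hlim)

/-- A conservation law for the equation `i ∂ₜφ = S⁻¹ φ - φ + N(φ)`, where `S = ι* ι`, whose
solutions are only assumed to satisfy it after applying `S` and testing against a dense family: if
the functional `I` has the discrete gradient `G`, with `G u w → 2 N(w)` as `u → w`, then
`‖φ‖² + I(φ)` is constant. -/
theorem norm_sq_add_eq_of_weak_equation [CompleteSpace X] {Y : Type*} [NormedAddCommGroup Y]
    [InnerProductSpace ℂ Y] [CompleteSpace Y] {ι : X → Y} (hadd : ∀ u w, ι (u + w) = ι u + ι w)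
    (hsmul : ∀ (c : ℂ) u, ι (c • u) = c • ι u) (hle : ∀ u, ‖ι u‖ ≤ ‖u‖)
    (hinj : ∀ u, ι u = 0 → u = 0) {κ : Type*} {v : κ → X} (hv : DenseRange v) {N : X → X}
    (hN : Continuous N) (hNim : ∀ u, (inner ℂ (ι (N u)) (ι u)).im = 0) {G : X → X → X}
    (hG : ∀ w, Tendsto (fun u => G u w) (𝓝 w) (𝓝 (N w + N w))) {I : X → ℝ}
    (hI : ∀ u w, I u - I w = (inner ℂ (ι (G u w)) (ι (u - w))).re) {J : Set ℝ}
    (hJ : J.OrdConnected) (h0 : (0 : ℝ) ∈ J) {φ : ℝ → X} (hφ : ContinuousOn φ J)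
    (heq : ∀ a, ∀ t ∈ J, HasDerivWithinAt (fun s => inner ℂ (ι (v a)) (ι (φ s)))
      (-Complex.I * (inner ℂ (v a) (φ t) - inner ℂ (ι (v a)) (ι (φ t)) +
        inner ℂ (ι (v a)) (ι (N (φ t))))) J t)
    {t : ℝ} (ht : t ∈ J) : ‖φ t‖ ^ 2 + I (φ t) = ‖φ 0‖ ^ 2 + I (φ 0) := by
  let T : X →L[ℂ] Y := LinearMap.mkContinuous ⟨⟨ι, hadd⟩, hsmul⟩ 1 fun u => by
    rw [one_mul]
    exact hle u
  obtain ⟨S, hS⟩ : ∃ S : X →L[ℂ] X, ∀ u w, inner ℂ u (S w) = inner ℂ (ι u) (ι w) :=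
    ⟨(ContinuousLinearMap.adjoint T) ∘L T, fun u w =>
      ContinuousLinearMap.adjoint_inner_right T u (T w)⟩
  have hS' : ∀ u w, inner ℂ (S u) w = inner ℂ (ι u) (ι w) := fun u w => by
    rw [← inner_conj_symm, hS, inner_conj_symm]
  have hsym : ∀ x y, inner ℂ (S x) y = inner ℂ x (S y) := fun x y => by rw [hS, hS']
  have hpos : ∀ x, 0 ≤ (inner ℂ (S x) x).re := fun x => by
    rw [hS']
    exact inner_self_nonneg (𝕜 := ℂ) (x := ι x)
  have hdense : DenseRange S :=
    denseRange_of_inner_eq_zero S (map_add S) (map_smul S) fun u hu => hinj u <| by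
      have h := hu u
      rwa [hS', inner_self_eq_zero] at h
  have hI' : ∀ u w, I u - I w = (inner ℂ (G u w) (S u - S w)).re := fun u w => by
    rw [hI, ← hS, map_sub]
  simp only [← hS] at heq
  have hNφ : ContinuousOn (fun t => N (φ t)) J := hN.comp_continuousOn hφ
  have hSφ : ∀ t ∈ J, HasDerivWithinAt (fun s => S (φ s))
      (-Complex.I • (φ t - S (φ t) + S (N (φ t)))) J t := fun t ht => by
    refine hasDerivWithinAt_of_dense_inner hv hJ.convex
      (k := fun t => -Complex.I • (φ t - S (φ t) + S (N (φ t)))) ?_ (fun a t ht => ?_) ht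
    · exact ((hφ.sub (S.continuous.comp_continuousOn hφ)).add
        (S.continuous.comp_continuousOn hNφ)).const_smul (-Complex.I)
    · simp only [inner_smul_right, inner_add_right, inner_sub_right]
      exact heq a t ht
  refine norm_sq_add_eq_of_hasDerivWithinAt S hsym hpos hdense hJ h0 hφ hNφ hSφ
    (F := fun t => I (φ t)) (fun t ht => ?_) ht
  have h1 := hasDerivWithinAt_iff_tendsto_slope.1 (hSφ t ht)
  have h2 : Tendsto φ (𝓝[J \ {t}] t) (𝓝 (φ t)) :=
    (hφ t ht).mono_left (nhdsWithin_mono _ Set.sdiff_subset)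
  -- By `hI'` the slope of `I ∘ φ` is the real inner product of `G (φ s) (φ t)` with the slope of `S
  -- ∘ φ`. Both factors converge, although `φ` itself need not be differentiable.
  have h4 := (Complex.continuous_re.tendsto _).comp (((hG (φ t)).comp h2).inner (𝕜 := ℂ) h1)
  rw [hasDerivWithinAt_iff_tendsto_slope]
  have e1 : (inner ℂ (N (φ t) + N (φ t)) (-Complex.I • (φ t - S (φ t) + S (N (φ t))))).re =
      -(2 * (inner ℂ (φ t) (N (φ t))).im) := by
    have h5 : (inner ℂ (N (φ t)) (φ t)).im = -(inner ℂ (φ t) (N (φ t))).im :=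
      inner_im_symm (𝕜 := ℂ) _ _
    have h7 : (inner ℂ (N (φ t)) (S (N (φ t)))).im = 0 :=
      Complex.conj_eq_iff_im.1 (by rw [inner_conj_symm, hsym])
    have h6 : (inner ℂ (N (φ t)) (S (φ t))).im = 0 := by rw [hS, hNim]
    rw [inner_smul_right, inner_add_left, inner_add_right, inner_sub_right]
    simp [h5, h6, h7]
    ring
  rw [e1] at h4
  refine h4.congr fun s => ?_
  simp only [Function.comp_apply, slope, vsub_eq_sub, hI']
  rw [← Complex.coe_smul, inner_smul_right, smul_eq_mul, Complex.re_ofReal_mul]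

end Hilbert

/-! ### The Hartree nonlinearity on `H¹` -/

theorem H1_ext_ae {u v : H1} (h : toL2 u =ᵐ[volume] toL2 v) : u = v :=
  H1_ext (Lp.ext h)

theorem denseRange_ofSchwartz_conjS : DenseRange fun ψ => ofSchwartz (conjS ψ) := by
  have h : Function.Surjective conjS := fun ψ => ⟨conjS ψ, conjS_conjS ψ⟩
  have := h.range_comp ofSchwartz
  rw [DenseRange, Function.comp_def] at *
  rw [this]
  exact denseRange_ofSchwartz

variable {lam : ℝ}

theorem bddLip_meanPot_dens (hlam : 0 ≤ lam) (u : H1) : BddLip (meanPot lam (dens u))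
    (lam / 2 * (2 * (4 * ‖u‖ ^ 2 * (4 * ‖u‖ ^ 2)) + 2 * (4 * ‖u‖ ^ 2 * (4 * ‖u‖ ^ 2)))) :=
  bddLip_meanPot hlam (hardyDensity_dens u)

/-- The nonlinearity of the quintic Hartree equation as a map `H¹ → H¹`. -/
def nonlin (hlam : 0 ≤ lam) (u : H1) : H1 := ((bddLip_meanPot_dens hlam u).exists_mul u).choose

theorem coeFn_nonlin (hlam : 0 ≤ lam) (u : H1) :
    toL2 (nonlin hlam u) =ᵐ[volume] fun x => (meanPot lam (dens u) x : ℂ) * toL2 u x :=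
  ((bddLip_meanPot_dens hlam u).exists_mul u).choose_spec.1

theorem tendsto_of_norm_sub_le {α : Type*} [TopologicalSpace α] {E : Type*}
    [SeminormedAddCommGroup E] {f : α → E} {y : E} {B : α → ℝ} {v : α} (hB : Continuous B)
    (h0 : B v = 0) (h : ∀ u, ‖f u - y‖ ≤ B u) : Tendsto f (𝓝 v) (𝓝 y) := by
  rw [tendsto_iff_norm_sub_tendsto_zero]
  refine squeeze_zero (fun _ => norm_nonneg _) h ?_
  rw [← h0]
  exact hB.tendsto v

theorem continuous_nonlin (hlam : 0 ≤ lam) : Continuous (nonlin hlam) := by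
  refine continuous_iff_continuousAt.2 fun v => ?_
  have hbound : ∀ u, ‖nonlin hlam u - nonlin hlam v‖ ≤
      3 * (lam / 2 * (2 * (4 * (‖u + v‖ * ‖u - v‖) * (4 * ‖u‖ ^ 2 + 4 * ‖v‖ ^ 2)) +
        2 * (4 * (‖u + v‖ * ‖u - v‖) * (4 * ‖u‖ ^ 2) +
          4 * ‖v‖ ^ 2 * (4 * (‖u + v‖ * ‖u - v‖))))) * ‖u‖ +
      3 * (lam / 2 * (2 * (4 * ‖v‖ ^ 2 * (4 * ‖v‖ ^ 2)) + 2 * (4 * ‖v‖ ^ 2 * (4 * ‖v‖ ^ 2)))) *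
        ‖u - v‖ := by
    intro u
    -- With `m` the mean potential, `m_u u - m_v v = (m_u - m_v) u + m_v (u - v)`.
    obtain ⟨w₁, h1, h1'⟩ := (bddLip_meanPot_sub hlam (hardyDensity_dens u) (hardyDensity_dens v)
      (hardyDensity_dens_sub u v)).exists_mul u
    obtain ⟨w₂, h2, h2'⟩ := (bddLip_meanPot_dens hlam v).exists_mul (u - v)
    have : nonlin hlam u - nonlin hlam v = w₁ + w₂ := by
      apply H1_ext_ae
      filter_upwards [coeFn_toL2_sub (nonlin hlam u) (nonlin hlam v), coeFn_toL2_add w₁ w₂,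
        coeFn_nonlin hlam u, coeFn_nonlin hlam v, h1, h2, coeFn_toL2_sub u v]
        with x e1 e2 e3 e4 e5 e6 e7
      rw [e1, e2, e3, e4, e5, e6, e7]
      push_cast
      ring
    rw [this]
    exact (norm_add_le _ _).trans (add_le_add h1' h2')
  refine tendsto_of_norm_sub_le (B := fun u => _) ?_ ?_ hbound
  · fun_prop
  · simp

/-- The discrete version of twice the nonlinearity. -/
def nonlinDiff (hlam : 0 ≤ lam) (u v : H1) : H1 :=
  ((bddLip_meanPotDiff hlam (hardyDensity_dens u) (hardyDensity_dens v)).exists_mul (u + v)).choose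

theorem coeFn_nonlinDiff (hlam : 0 ≤ lam) (u v : H1) : toL2 (nonlinDiff hlam u v) =ᵐ[volume]
    fun x => (meanPotDiff lam (dens u) (dens v) x : ℂ) * toL2 (u + v) x :=
  ((bddLip_meanPotDiff hlam (hardyDensity_dens u) (hardyDensity_dens v)).exists_mul
    (u + v)).choose_spec.1

theorem tendsto_nonlinDiff (hlam : 0 ≤ lam) (v : H1) :
    Tendsto (fun u => nonlinDiff hlam u v) (𝓝 v) (𝓝 (nonlin hlam v + nonlin hlam v)) := by
  have hbound : ∀ u, ‖nonlinDiff hlam u v - (nonlin hlam v + nonlin hlam v)‖ ≤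
      3 * (lam / 2 * (2 * (4 * (‖u + v‖ * ‖u - v‖) * (4 * ‖u‖ ^ 2 + 4 * ‖v‖ ^ 2)) +
        4 * (‖u + v‖ * ‖u - v‖) * (4 * ‖v‖ ^ 2))) * ‖u + v‖ +
      3 * (lam / 2 * (2 * (4 * ‖v‖ ^ 2 * (4 * ‖v‖ ^ 2)) + 2 * (4 * ‖v‖ ^ 2 * (4 * ‖v‖ ^ 2)))) *
        ‖u - v‖ := by
    intro u
    -- With `d` the discrete potential, `d (u + v) - 2 m_v v = (d - m_v)(u + v) + m_v (u - v)`.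
    obtain ⟨w₁, h1, h1'⟩ := (bddLip_meanPotDiff_sub hlam (hardyDensity_dens u)
      (hardyDensity_dens v) (hardyDensity_dens_sub u v)).exists_mul (u + v)
    obtain ⟨w₂, h2, h2'⟩ := (bddLip_meanPot_dens hlam v).exists_mul (u - v)
    have : nonlinDiff hlam u v - (nonlin hlam v + nonlin hlam v) = w₁ + w₂ := by
      apply H1_ext_ae
      filter_upwards [coeFn_toL2_sub (nonlinDiff hlam u v) (nonlin hlam v + nonlin hlam v),
        coeFn_toL2_add w₁ w₂, coeFn_nonlinDiff hlam u v, coeFn_nonlin hlam v, h1, h2,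
        coeFn_toL2_sub u v, coeFn_toL2_add u v, coeFn_toL2_add (nonlin hlam v) (nonlin hlam v)]
        with x e1 e2 e3 e4 e5 e6 e7 e8 e9
      rw [e1, e2, e3, e9, e4, e5, e6, e7, e8]
      push_cast
      ring
    rw [this]
    exact (norm_add_le _ _).trans (add_le_add h1' h2')
  refine tendsto_of_norm_sub_le (B := fun u => _) ?_ ?_ hbound
  · fun_prop
  · simp

theorem interaction_dens_sub (hlam : 0 ≤ lam) (u v : H1) :
    interaction lam (dens u) - interaction lam (dens v) =
      (inner ℂ (toL2 (nonlinDiff hlam u v)) (toL2 (u - v))).re := by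
  rw [interaction_sub (hardyDensity_dens u) (hardyDensity_dens v),
    L2.inner_def, ← RCLike.re_eq_complex_re,
    ← integral_re (L2.integrable_inner _ _)]
  apply integral_congr_ae
  filter_upwards [dens_sub_dens u v, coeFn_nonlinDiff hlam u v] with x h1 h2
  rw [h1, h2, ← Complex.re_ofReal_mul]
  simp
  ring

theorem im_inner_nonlin (hlam : 0 ≤ lam) (u : H1) :
    (inner ℂ (toL2 (nonlin hlam u)) (toL2 u)).im = 0 := by
  rw [L2.inner_def]
  have : ∀ᵐ x, inner ℂ (toL2 (nonlin hlam u) x) (toL2 u x) =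
      ((meanPot lam (dens u) x * dens u x : ℝ) : ℂ) := by
    filter_upwards [coeFn_nonlin hlam u] with x hx
    rw [hx, dens, ← Complex.normSq_eq_norm_sq]
    push_cast
    rw [Complex.normSq_eq_conj_mul_self]
    simp
    ring
  rw [integral_congr_ae this, integral_complex_ofReal, Complex.ofReal_im]

/-! ### Conservation and the a priori bound for solutions -/

section Solution

variable {J : Set ℝ} {φ₀ : H1} {φ : ℝ → H1}

theorem IsSolution.hasDerivWithinAt_inner (hlam : 0 ≤ lam) (hsol : IsSolution lam J φ₀ φ)
    (ψ : 𝓢(E3, ℂ)) {t : ℝ} (ht : t ∈ J) :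
    HasDerivWithinAt (fun s => inner ℂ (toL2 (ofSchwartz (conjS ψ))) (toL2 (φ s)))
      (-Complex.I * (inner ℂ (ofSchwartz (conjS ψ)) (φ t) -
        inner ℂ (toL2 (ofSchwartz (conjS ψ))) (toL2 (φ t)) +
        inner ℂ (toL2 (ofSchwartz (conjS ψ))) (toL2 (nonlin hlam (φ t))))) J t := by
  obtain ⟨d, hd, hd2⟩ := hsol.equation t ht ψ
  have hp : ∀ f : L2, inner ℂ (toL2 (ofSchwartz (conjS ψ))) f = pair ψ f := fun f => by
    rw [toL2_ofSchwartz, inner_schwartzL2, conjS_conjS]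
  have hΔ : (Δ (toL2 (φ t) : 𝓢'(E3, ℂ))) ψ = pair (Δ ψ) (toL2 (φ t)) :=
    TemperedDistribution.laplacian_apply_apply _ _
  have hN : ∫ x, ψ x * ((meanField lam (toL2 (φ t)) x : ℂ) * toL2 (φ t) x) =
      pair ψ (toL2 (nonlin hlam (φ t))) := by
    rw [pair_apply]
    apply integral_congr_ae
    filter_upwards [coeFn_nonlin hlam (φ t)] with x hx
    rw [hx, meanField_toL2]
  simp only [hp]
  refine hd.congr_deriv ?_
  rw [inner_ofSchwartz]
  rw [hΔ, hN] at hd2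
  -- Multiplying the equation by `-i` isolates `d`; the Laplacian term is the `H¹` pairing minus the
  -- `L²` pairing.
  linear_combination (-Complex.I) * hd2 + d * Complex.I_mul_I

/-- Since `‖φ‖²` is mass plus kinetic energy, no separate conservation of mass is needed. -/
theorem IsSolution.energy_eq (hlam : 0 ≤ lam) (hJ : J.OrdConnected) (h0 : (0 : ℝ) ∈ J)
    (hsol : IsSolution lam J φ₀ φ) {t : ℝ} (ht : t ∈ J) :
    ‖φ t‖ ^ 2 + interaction lam (dens (φ t)) = ‖φ₀‖ ^ 2 + interaction lam (dens φ₀) := by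
  rw [← hsol.initial]
  exact norm_sq_add_eq_of_weak_equation (map_add toL2CLM) (map_smul toL2CLM) norm_toL2_le
    (fun u hu => H1_ext (hu.trans (map_zero toL2CLM).symm)) denseRange_ofSchwartz_conjS
    (continuous_nonlin hlam) (im_inner_nonlin hlam) (tendsto_nonlinDiff hlam)
    (I := fun u => interaction lam (dens u)) (interaction_dens_sub hlam) hJ h0 hsol.continuousOn
    (fun ψ t ht => hsol.hasDerivWithinAt_inner hlam ψ ht) ht

theorem IsSolution.norm_le (hlam : 0 ≤ lam) (hJ : J.OrdConnected) (h0 : (0 : ℝ) ∈ J)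
    (hsol : IsSolution lam J φ₀ φ) {M : ℝ} (hM : ‖φ₀‖ < M) {t : ℝ} (ht : t ∈ J) :
    ‖φ t‖ ≤ √(M ^ 2 + lam * (4 * M ^ 2) ^ 3) := by
  apply Real.le_sqrt_of_sq_le
  calc ‖φ t‖ ^ 2 ≤ ‖φ t‖ ^ 2 + interaction lam (dens (φ t)) :=
        le_add_of_nonneg_right (interaction_nonneg hlam _)
    _ = ‖φ₀‖ ^ 2 + interaction lam (dens φ₀) := hsol.energy_eq hlam hJ h0 ht
    _ ≤ ‖φ₀‖ ^ 2 + lam * (4 * ‖φ₀‖ ^ 2) ^ 3 := by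
        gcongr
        exact interaction_le hlam (hardyDensity_dens φ₀)
    _ ≤ M ^ 2 + lam * (4 * M ^ 2) ^ 3 := by gcongr

end Solution

end QuinticHartree
end

theorem mainTheorem8 (lam : ℝ) (hlam : 0 < lam) (M : ℝ) :
    ∃ C : ℝ, ∀ (φ₀ : QuinticHartree.H1) (J : Set ℝ) (φ : ℝ → QuinticHartree.H1),
      J.OrdConnected → (0 : ℝ) ∈ J → QuinticHartree.IsSolution lam J φ₀ φ →
      ‖φ₀‖ < M → ∀ t ∈ J, ‖φ t‖ ≤ C :=
  ⟨√(M ^ 2 + lam * (4 * M ^ 2) ^ 3), fun _ _ _ hJ h0 hsol hM _ ht =>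
    hsol.norm_le hlam.le hJ h0 hM ht⟩
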